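/- Let $K$ be a field with $\operatorname{char} K \neq 2,3$, let $K^{\mathrm{sep}}$ be a separable closure of $K$, and let $G_K=\operatorname{Gal}(K^{\mathrm{sep}}/K)$ with the Krull topology. Let $M$ be a (discrete) $K$-Galois module of order $3$, i.e. an abelian group of order $3$ with a continuous action of $G_K$ by automorphisms. Let $M'=\operatorname{Hom}(M,\mu_3)$ be its Tate dual, with action $(gf)(x)=g(f(g^{-1}x))$. Let $T'$ be the quadratic étale $K$-algebra corresponding to $M'$: that is, an étale $K$-algebra with a $G_K$-equivariant bijection $\iota\mapsto f_\iota$ from its set of coordinates $C=\operatorname{Hom}_{K\text{-alg}}(T',K^{\mathrm{sep}})$ to the set of elements of maximal order (i.e. the nonzero elements) of $M'$. Embed $T'$ in $(K^{\mathrm{sep}})^2=(K^{\mathrm{sep}})^{C}$ by its coordinates, write $T'^{N=1}$ for the group of units of $T'$ of norm $1$ over $K$, and let $$\Omega=\big((K^{\mathrm{sep}})^2\big)^{N=1}[3]=\{\omega\in (K^{\mathrm{sep}})^{C} : \omega^3=1,\ N(\omega)=1\}.$$ Then $x\mapsto\omega_x:=(f_\iota(x))_{\iota\in C}$ is a bijection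 $M\to\Omega$, and there is a group isomorphism $$H^1(K,M)\;\cong\; T'^{N=1}/(T'^{N=1})^3$$ ($H^1$ being continuous $1$-cocycles modulo coboundaries) with the following property. Let $\delta\in T'^{N=1}$. There exists $\theta=\sqrt[3]{\delta}\in (K^{\mathrm{sep}})^2$ with $\theta^3=\delta$ and $N(\theta)=1$, and for every such $\theta$ the image $L$ of the $K$-linear map $$\kappa: K\times T'\to (K^{\mathrm{sep}})^{\Omega},\qquad (a,\xi)\mapsto \big(a+\operatorname{tr}_{(K^{\mathrm{sep}})^2/K^{\mathrm{sep}}}(\xi\,\omega\,\theta)\big)_{\omega\in\Omega}$$ is a cubic étale $K$-subalgebra of $(K^{\mathrm{sep}})^{\Omega}\cong (K^{\mathrm{sep}})^3$ whose coordinates are exactly the three distinct projections $\pi_x:y\mapsto y_{\omega_x}$, $x\in M$. The class of $\delta$ corresponds to $L$ in the following sense: for every continuous cocycle $\sigma:G_K\to M$, the isomorphism sends $[\sigma]$ to the class of $\delta$ if and only if there is $t\in M$ such that the labelling $\iota_x=\pi_{x+t}$ $(x\in M)$ of the coordinates of $L$ satisfies $$g\circ\iota_x=\iota_{gx+\sigma(g)}\qquad\text{for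 all } g\in G_K,\ x\in M.$$ -/

import Mathlib

namespace KummerCubic

noncomputable section

/-! ## Galois cohomology in degree one, by continuous inhomogeneous cochains -/

/-- `Z¹(G, M)`: continuous crossed homomorphisms `σ : G → M`,
`σ (g h) = σ g + g • σ h`, under pointwise addition. -/
def Z1 (G M : Type*) [Group G] [TopologicalSpace G] [AddCommGroup M] [TopologicalSpace M]
    [IsTopologicalAddGroup M] [DistribMulAction G M] : AddSubgroup (G → M) where
  carrier := {σ | Continuous σ ∧ ∀ g h : G, σ (g * h) = σ g + g • σ h}
  zero_mem' := ⟨continuous_const, fun g h => by simp⟩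
  add_mem' := by
    rintro a b ⟨ha, ha'⟩ ⟨hb, hb'⟩
    refine ⟨ha.add hb, fun g h => ?_⟩
    simp only [Pi.add_apply, ha', hb', smul_add]
    abel
  neg_mem' := by
    rintro a ⟨ha, ha'⟩
    refine ⟨ha.neg, fun g h => ?_⟩
    simp only [Pi.neg_apply, ha', smul_neg]
    abel

/-- `B¹(G, M)`: the coboundaries `g ↦ g • u - u`, as a subgroup of `Z¹(G, M)`. -/
def B1 (G M : Type*) [Group G] [TopologicalSpace G] [AddCommGroup M] [TopologicalSpace M]
    [IsTopologicalAddGroup M] [DistribMulAction G M] : AddSubgroup (Z1 G M) where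
  carrier := {σ | ∃ u : M, ∀ g : G, (σ : G → M) g = g • u - u}
  zero_mem' := ⟨0, fun g => by simp⟩
  add_mem' := by
    rintro a b ⟨u, hu⟩ ⟨v, hv⟩
    refine ⟨u + v, fun g => ?_⟩
    simp only [AddSubgroup.coe_add, Pi.add_apply, hu, hv, smul_add]
    abel
  neg_mem' := by
    rintro a ⟨u, hu⟩
    refine ⟨-u, fun g => ?_⟩
    simp only [AddSubgroup.coe_neg, Pi.neg_apply, hu, smul_neg]
    abel

/-- `H¹(G, M) = Z¹(G, M) / B¹(G, M)`. -/
abbrev H1 (G M : Type*) [Group G] [TopologicalSpace G] [AddCommGroup M] [TopologicalSpace M]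
    [IsTopologicalAddGroup M] [DistribMulAction G M] : Type _ :=
  Z1 G M ⧸ B1 G M

/-! ## The Tate dual -/

/-- The Tate dual `M' = Hom(M, μ_m)`, where `m` is the exponent of `M` and
`μ_m` is the group of `m`-th roots of unity in `Ks`. -/
def TateDual (Ks M : Type*) [Field Ks] [AddCommGroup M] : Type _ :=
  M →+ Additive (rootsOfUnity (AddMonoid.exponent M) Ks)

instance (Ks M : Type*) [Field Ks] [AddCommGroup M] : AddCommGroup (TateDual Ks M) :=
  inferInstanceAs (AddCommGroup (M →+ Additive (rootsOfUnity (AddMonoid.exponent M) Ks)))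

/-- The value `f x ∈ μ_m ⊆ Ks` of `f ∈ M'` at `x ∈ M`. -/
def TateDual.eval {Ks M : Type*} [Field Ks] [AddCommGroup M] (f : TateDual Ks M) (x : M) : Ks :=
  ((Additive.toMul ((show M →+ Additive (rootsOfUnity (AddMonoid.exponent M) Ks) from f) x) :
    rootsOfUnity (AddMonoid.exponent M) Ks) : Ksˣ)

/-- The Galois action on the Tate dual, `(g f)(x) = g (f (g⁻¹ x))`. -/
instance (K Ks M : Type*) [Field K] [Field Ks] [Algebra K Ks] [AddCommGroup M]
    [DistribMulAction Gal(Ks/K) M] : SMul Gal(Ks/K) (TateDual Ks M) where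
  smul g f := (MonoidHom.toAdditive (restrictRootsOfUnity g (AddMonoid.exponent M))).comp
    (AddMonoidHom.comp (show M →+ Additive (rootsOfUnity (AddMonoid.exponent M) Ks) from f)
      (DistribSMul.toAddMonoidHom M g⁻¹))

theorem TateDual.eval_smul {K Ks M : Type*} [Field K] [Field Ks] [Algebra K Ks] [AddCommGroup M]
    [DistribMulAction Gal(Ks/K) M] (g : Gal(Ks/K)) (f : TateDual Ks M) (x : M) :
    (g • f).eval x = g (f.eval (g⁻¹ • x)) := rfl

/-- `M⁻`: the elements of maximal order in a finite abelian group `M`,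
that is, those whose order is the exponent of `M`. -/
def MaxOrder (M : Type*) [AddCommGroup M] : Type _ :=
  {x : M // addOrderOf x = AddMonoid.exponent M}

/-! ## Étale algebras and their coordinates -/

/-- The coordinates of a `K`-algebra `L`: its `K`-algebra maps to `Ks`. -/
abbrev Coord (K Ks L : Type*) [Field K] [Field Ks] [Algebra K Ks] [CommRing L] [Algebra K L] :
    Type _ :=
  L →ₐ[K] Ks

/-- The Galois action on coordinates, `(g ι)(x) = g (ι x)`. -/
def galCoord {K Ks L : Type*} [Field K] [Field Ks] [Algebra K Ks] [CommRing L] [Algebra K L]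
    (g : Gal(Ks/K)) (ι : Coord K Ks L) : Coord K Ks L :=
  (g : Ks →ₐ[K] Ks).comp ι

/-- The Minkowski embedding `L → Ksⁿ`, the coordinates of `Ksⁿ` being indexed by those of `L`. -/
def minkowski (K Ks L : Type*) [Field K] [Field Ks] [Algebra K Ks] [CommRing L] [Algebra K L] :
    L →ₐ[K] (Coord K Ks L → Ks) :=
  AlgHom.pi (fun ι => ι)

/-- The labelling `x ↦ ι_x` of the coordinates of `L` by the elements of `M` exhibits `L` as the
algebra attached to the cocycle `σ`: `g ∘ ι_x = ι_{g x + σ(g)}` for all `g`, `x`. -/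
def IsLabelling {K Ks M L : Type*} [Field K] [Field Ks] [Algebra K Ks] [AddCommGroup M]
    [DistribMulAction Gal(Ks/K) M] [CommRing L] [Algebra K L]
    (σ : Gal(Ks/K) → M) (ι : M ≃ Coord K Ks L) : Prop :=
  ∀ (g : Gal(Ks/K)) (x : M), galCoord g (ι x) = ι (g • x + σ g)

/-! ## Norm-one elements and the map `κ` -/

/-- `T^{N=1}`: the group of units of norm `1` of a `K`-algebra `T`. -/
abbrev NormOne (K T : Type*) [Field K] [CommRing T] [Algebra K T] : Subgroup Tˣ :=
  (Units.map (Algebra.norm K : T →* K)).ker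

/-- `T^{N=1} / (T^{N=1})³`. -/
abbrev NormOneModCubes (K T : Type*) [Field K] [CommRing T] [Algebra K T] : Type _ :=
  NormOne K T ⧸ (powMonoidHom 3 : NormOne K T →* NormOne K T).range

/-- `(Ks²)^{N=1}[3]`: the cube roots of `1` of norm `1` in the `Ks`-algebra of functions `C → Ks`
(where `C` will be the two-element set of coordinates of a quadratic algebra). -/
def Omega (Ks C : Type*) [Field Ks] : Type _ :=
  {ω : C → Ks // ω ^ 3 = 1 ∧ Algebra.norm Ks ω = 1}

/-- The `K`-linear map `κ : K × T → Ks³`, `(a, ξ) ↦ (a + tr_{Ks²/Ks} (ξ ω θ))_ω`, where `θ ∈ Ks²`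
is a cube root of `δ`, the algebra `T` is embedded in `Ks²` by its two coordinates,
and `ω` runs through `(Ks²)^{N=1}[3]`. -/
def kappa (K Ks T : Type*) [Field K] [Field Ks] [Algebra K Ks] [CommRing T] [Algebra K T]
    (θ : Coord K Ks T → Ks) : (K × T) →ₗ[K] (Omega Ks (Coord K Ks T) → Ks) where
  toFun p := fun ω => algebraMap K Ks p.1 +
    Algebra.trace Ks (Coord K Ks T → Ks) (minkowski K Ks T p.2 * ω.1 * θ)
  map_add' p q := by
    funext ω
    simp only [Prod.fst_add, Prod.snd_add, map_add, add_mul, Pi.add_apply]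
    abel
  map_smul' c p := by
    funext ω
    have h : minkowski K Ks T (c • p.2) * ω.1 * θ
        = algebraMap K Ks c • (minkowski K Ks T p.2 * ω.1 * θ) := by
      rw [map_smul, algebraMap_smul, smul_mul_assoc, smul_mul_assoc]
    have h' : algebraMap K Ks (c • p.1) = algebraMap K Ks c • algebraMap K Ks p.1 := by
      rw [smul_eq_mul, smul_eq_mul, map_mul]
    change algebraMap K Ks (c • p.1) + Algebra.trace Ks _ (minkowski K Ks T (c • p.2) * ω.1 * θ)
      = c • (algebraMap K Ks p.1 + Algebra.trace Ks _ (minkowski K Ks T p.2 * ω.1 * θ))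
    rw [h, h', map_smul, ← smul_add, algebraMap_smul]

end

end KummerCubic

/-! The nonzero elements of `M'` are the two nontrivial characters of `M`, so evaluation is an
equivariant pairing `χ` of `M` with the coordinates of `T'` (`IsCubicPairing`). It identifies `M`
with `Ω`, the kernel of cubing on norm-one elements of `Ksⁿ`. Descent (`exists_minkowski_eq`)
identifies the invariant norm-one elements with `T'^{N=1}`, and Kummer theory attaches to `δ` the
cocycle `g ↦ gθ/θ` with values in `M`.

The kernel of this map consists of the cubes. Surjectivity needs more, since the norm-one group need
not satisfy Hilbert 90. The full group `(Ksⁿ)ˣ` does (`exists_twisted_invariant`), and as `n = 2`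
and `3M = 0`, a solution there can be corrected to norm one (`exists_isKummerClass_of_cocycle`).

For the algebra, view functions on `Ω` as functions on `M`. The map `κ` writes down Fourier
expansions: `a` is the coefficient of the trivial character and `ι(ξ)θ_ι` that of `χ_ι`. By Fourier
inversion its image is the set of `y` with `g(y_x) = y_{gx+c(g)}`, where `c` is the cocycle of `θ`
(`range_kappa`). This is visibly an algebra, labelled by `c`. Translating the labelling by `t`
changes `c` by a coboundary, whence the final equivalence. -/

namespace KummerCubic

noncomputable section

/-! ## Étale algebras over a field and their coordinates -/

section Coordinates

variable {K Ks T : Type*} [Field K] [Field Ks] [Algebra K Ks] [CommRing T] [Algebra K T]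

-- Over `Ks` the algebra splits as `Ksⁿ`. The `n` projections remain distinct on `T`, because a
-- `Ks`-algebra map out of `Ks ⊗ T` is determined by its restriction to `T`.
open scoped TensorProduct in
theorem finrank_le_card_coord [IsSepClosed Ks] [Algebra.Etale K T] [Finite (Coord K Ks T)] :
    Module.finrank K T ≤ Nat.card (Coord K Ks T) := by
  obtain ⟨n, ⟨f⟩⟩ := Algebra.IsFiniteSplit.nonempty_algEquiv_fun Ks (Ks ⊗[K] T)
  have hn : Module.finrank K T = n := by
    rw [← Module.finrank_baseChange (R := Ks), f.toLinearEquiv.finrank_eq, Module.finrank_fin_fun]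
  let p : Fin n → Coord K Ks T := fun i =>
    (((Pi.evalAlgHom Ks (fun _ : Fin n => Ks) i).comp f.toAlgHom).restrictScalars K).comp
      Algebra.TensorProduct.includeRight
  have hp : Function.Injective p := by
    intro i j hij
    have h : (Pi.evalAlgHom Ks (fun _ : Fin n => Ks) i).comp f.toAlgHom
        = (Pi.evalAlgHom Ks (fun _ : Fin n => Ks) j).comp f.toAlgHom := by
      apply Algebra.TensorProduct.ext (Subsingleton.elim _ _)
      exact hij
    by_contra hne
    have := DFunLike.congr_fun h (f.symm (Pi.single i 1))
    simp [Ne.symm hne] at this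
  rw [hn]
  simpa using Nat.card_le_card_of_injective p hp

theorem linearIndependent_coord :
    LinearIndependent Ks (fun ι : Coord K Ks T => (ι : T → Ks)) :=
  (linearIndependent_monoidHom T Ks).comp (fun ι : Coord K Ks T => (ι : T →* Ks))
    fun _ _ h => AlgHom.ext fun x => DFunLike.congr_fun h x

theorem card_coord_le_finrank [Module.Finite K T] [Finite (Coord K Ks T)] :
    Nat.card (Coord K Ks T) ≤ Module.finrank K T := by
  have := Fintype.ofFinite (Coord K Ks T)
  have h := (linearIndependent_toLinearMap K T Ks).fintype_card_le_finrank
  rwa [Module.finrank_linearMap, Module.finrank_self, mul_one, ← Nat.card_eq_fintype_card] at h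

theorem finrank_eq_card_coord [IsSepClosed Ks] [Algebra.Etale K T] [Finite (Coord K Ks T)] :
    Module.finrank K T = Nat.card (Coord K Ks T) := by
  have := Algebra.FormallyUnramified.finite_of_free K T
  exact le_antisymm finrank_le_card_coord card_coord_le_finrank

theorem coord_sum_eq_zero [Fintype (Coord K Ks T)] {c : Coord K Ks T → Ks}
    (h : ∀ x : T, ∑ ι, c ι * ι x = 0) : c = 0 := by
  refine funext fun ι => (Fintype.linearIndependent_iff.mp
    (linearIndependent_coord (K := K) (Ks := Ks) (T := T))) c ?_ ι
  funext x
  simpa using h x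

/-- A basis of an étale algebra, indexed by its coordinates. -/
def coordBasis [IsSepClosed Ks] [Algebra.Etale K T] [Fintype (Coord K Ks T)] :
    Module.Basis (Coord K Ks T) K T :=
  haveI := Algebra.FormallyUnramified.finite_of_free K T
  (Module.finBasisOfFinrankEq K T (finrank_eq_card_coord (Ks := Ks))).reindex
    (Finite.equivFin _).symm

/-- The Minkowski embedding carries a `K`-basis of an étale algebra to a `Ks`-basis. -/
theorem linearIndependent_minkowski_coordBasis [IsSepClosed Ks] [Algebra.Etale K T]
    [Fintype (Coord K Ks T)] :
    LinearIndependent Ks fun j : Coord K Ks T => minkowski K Ks T (coordBasis (Ks := Ks) j) := by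
  classical
  -- The rows are the coordinates evaluated on a basis, independent by Dedekind; the columns are the
  -- vectors in question, and the matrix is square.
  let A : Matrix (Coord K Ks T) (Coord K Ks T) Ks := fun i j => i (coordBasis (Ks := Ks) j)
  have hA : LinearIndependent Ks A.row := by
    rw [Fintype.linearIndependent_iff]
    intro c hc
    refine fun i => congrFun (coord_sum_eq_zero (c := c) fun x => ?_) i
    have h : (∑ ι, c ι • ι.toLinearMap : T →ₗ[K] Ks) = 0 := by
      refine (coordBasis (K := K) (Ks := Ks) (T := T)).ext fun j => ?_
      simpa [A, Matrix.row] using congrFun hc j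
    simpa using DFunLike.congr_fun h x
  have h := Matrix.linearIndependent_cols_iff_isUnit.mpr
    (Matrix.linearIndependent_rows_iff_isUnit.mp hA)
  exact h

/-- The image in `Ksⁿ` of the basis `coordBasis`. -/
def minkowskiBasis [IsSepClosed Ks] [Algebra.Etale K T] [Fintype (Coord K Ks T)] :
    Module.Basis (Coord K Ks T) Ks (Coord K Ks T → Ks) :=
  Module.Basis.mk (linearIndependent_minkowski_coordBasis (K := K) (Ks := Ks) (T := T))
    (linearIndependent_minkowski_coordBasis.span_eq_top_of_card_eq_finrank' (by simp)).ge

theorem minkowskiBasis_apply [IsSepClosed Ks] [Algebra.Etale K T] [Fintype (Coord K Ks T)]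
    (j : Coord K Ks T) :
    minkowskiBasis j = minkowski K Ks T (coordBasis (Ks := Ks) j) := by
  simp [minkowskiBasis]

theorem norm_pi {F I : Type*} [Field F] [Fintype I] (v : I → F) :
    Algebra.norm F v = ∏ i, v i := by
  classical
  have h : Algebra.leftMulMatrix (Pi.basisFun F I) v = Matrix.diagonal v := by
    ext i j
    simp [Algebra.leftMulMatrix_eq_repr_mul, Pi.single_apply, Matrix.diagonal_apply]
  rw [Algebra.norm_eq_matrix_det (Pi.basisFun F I), h, Matrix.det_diagonal]

theorem trace_pi {F I : Type*} [Field F] [Fintype I] (v : I → F) :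
    Algebra.trace F (I → F) v = ∑ i, v i := by
  classical
  have h : Algebra.leftMulMatrix (Pi.basisFun F I) v = Matrix.diagonal v := by
    ext i j
    simp [Algebra.leftMulMatrix_eq_repr_mul, Pi.single_apply, Matrix.diagonal_apply]
  rw [Algebra.trace_eq_matrix_trace (Pi.basisFun F I), h, Matrix.trace_diagonal]

/-- Multiplication by `x` has the same matrix in a `K`-basis of `T` and in its image, a `Ks`-basis
of `Ksⁿ`. -/
theorem norm_minkowski [IsSepClosed Ks] [Algebra.Etale K T] [Finite (Coord K Ks T)] (x : T) :
    Algebra.norm Ks (minkowski K Ks T x) = algebraMap K Ks (Algebra.norm K x) := by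
  classical
  have := Fintype.ofFinite (Coord K Ks T)
  let b : Module.Basis (Coord K Ks T) K T := coordBasis
  have h : Algebra.leftMulMatrix minkowskiBasis (minkowski K Ks T x)
      = (Algebra.leftMulMatrix b x).map (algebraMap K Ks) := by
    ext i j
    have hm : minkowski K Ks T x * minkowskiBasis j
        = ∑ k, algebraMap K Ks (b.repr (x * b j) k) • minkowskiBasis k := by
      simp only [minkowskiBasis_apply, algebraMap_smul, ← map_mul, ← map_smul, ← map_sum]
      exact congrArg _ (b.sum_repr _).symm
    rw [Algebra.leftMulMatrix_eq_repr_mul, hm, Matrix.map_apply,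
      Algebra.leftMulMatrix_eq_repr_mul, Module.Basis.repr_sum_self]
  rw [Algebra.norm_eq_matrix_det minkowskiBasis, h, Algebra.norm_eq_matrix_det b,
    RingHom.map_det, RingHom.mapMatrix_apply]

theorem minkowski_injective [IsSepClosed Ks] [Algebra.Etale K T] [Finite (Coord K Ks T)] :
    Function.Injective (minkowski K Ks T) := by
  have := Fintype.ofFinite (Coord K Ks T)
  rw [injective_iff_map_eq_zero]
  intro x hx
  let b : Module.Basis (Coord K Ks T) K T := coordBasis
  let B : Module.Basis (Coord K Ks T) Ks (Coord K Ks T → Ks) := minkowskiBasis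
  have h : ∑ k, algebraMap K Ks (b.repr x k) • B k = 0 := by
    rw [← hx]
    conv_rhs => rw [← b.sum_repr x, map_sum]
    refine Finset.sum_congr rfl fun k _ => ?_
    rw [algebraMap_smul, map_smul]
    exact congrArg _ (minkowskiBasis_apply k)
  have h' := Fintype.linearIndependent_iff.mp B.linearIndependent _ h
  rw [← b.sum_repr x]
  exact Finset.sum_eq_zero fun k _ => by
    rw [(algebraMap K Ks).injective ((h' k).trans (map_zero _).symm), zero_smul]

end Coordinates

/-! ### Galois descent for étale algebras -/

section Descent

variable {K Ks T : Type*} [Field K] [Field Ks] [Algebra K Ks] [CommRing T] [Algebra K T]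

instance : MulAction Gal(Ks/K) (Coord K Ks T) where
  smul := galCoord
  one_smul _ := rfl
  mul_smul _ _ _ := rfl

theorem smul_coord_apply (g : Gal(Ks/K)) (ι : Coord K Ks T) (x : T) : (g • ι) x = g (ι x) := rfl

/-- Galois descent: the equivariant vectors of `Ksⁿ` are those coming from the étale algebra. -/
theorem exists_minkowski_eq [IsSepClosure K Ks] [Algebra.Etale K T] [Finite (Coord K Ks T)]
    {v : Coord K Ks T → Ks} (hv : ∀ (g : Gal(Ks/K)) ι, g (v ι) = v (g • ι)) :
    ∃ x : T, minkowski K Ks T x = v := by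
  have : IsSepClosed Ks := IsSepClosure.sep_closed K
  have := Fintype.ofFinite (Coord K Ks T)
  let b : Module.Basis (Coord K Ks T) K T := coordBasis
  let B : Module.Basis (Coord K Ks T) Ks (Coord K Ks T → Ks) := minkowskiBasis
  have hB : ∀ k ι, B k ι = ι (b k) := fun k ι => congrFun (minkowskiBasis_apply k) ι
  have hc : ∀ k, ∃ c : K, algebraMap K Ks c = B.repr v k := by
    intro k
    refine (InfiniteGalois.mem_range_algebraMap_iff_fixed _).mpr fun g => ?_
    -- Equivariance of `v` and of the basis vectors makes the conjugated coefficients another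
    -- expansion of `v`, so uniqueness shows that `g` fixes them.
    have h : ∑ j, g (B.repr v j) • B j = v := by
      funext ι
      obtain ⟨ι, rfl⟩ := MulAction.surjective g ι
      rw [← hv]
      nth_rw 2 [← B.sum_repr v]
      simp only [Finset.sum_apply, Pi.smul_apply, smul_eq_mul, map_sum, map_mul, hB,
        smul_coord_apply]
    nth_rw 2 [← h]
    rw [B.repr_sum_self]
  choose c hc using hc
  refine ⟨∑ k, c k • b k, ?_⟩
  rw [map_sum]
  conv_rhs => rw [← B.sum_repr v]
  refine Finset.sum_congr rfl fun k _ => ?_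
  rw [← hc, algebraMap_smul, map_smul]
  exact congrArg _ (minkowskiBasis_apply k).symm

end Descent

/-! ### Étaleness of finite subalgebras of powers of a separable extension -/

/-- An algebra all of whose elements are roots of separable polynomials is unramified. -/
theorem formallyUnramified_of_forall_exists_separable {K L : Type*} [Field K] [CommRing L]
    [Algebra K L] (h : ∀ y : L, ∃ p : Polynomial K, p.Separable ∧ Polynomial.aeval y p = 0) :
    Algebra.FormallyUnramified K L := by
  have hD : ∀ y : L, KaehlerDifferential.D K L y = 0 := by
    intro y
    obtain ⟨p, ⟨u, v, huv⟩, hpy⟩ := h y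
    -- This is `d(p(y)) = p'(y) dy`; the Bézout identity for `p` and `p'` makes `p'(y)` invertible.
    have h0 : Polynomial.aeval y (Polynomial.derivative p) • KaehlerDifferential.D K L y = 0 := by
      rw [← Derivation.map_aeval, hpy, map_zero]
    have h1 := congrArg (Polynomial.aeval y) huv
    rw [map_add, map_mul, map_mul, hpy, mul_zero, zero_add, map_one] at h1
    rw [← one_smul L (KaehlerDifferential.D K L y), ← h1, mul_smul, h0, smul_zero]
  refine ⟨?_⟩
  have hr : Set.range (KaehlerDifferential.D K L) ⊆ {(0 : Ω[L⁄K])} := by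
    rintro _ ⟨y, rfl⟩
    exact hD y
  have hbot := (Submodule.span_eq_bot (R := L)).mpr hr
  rw [KaehlerDifferential.span_range_derivation K L] at hbot
  exact (Submodule.subsingleton_iff L).mp (subsingleton_of_bot_eq_top hbot.symm)

/-- Multiply the minimal polynomials of the entries, each taken once: distinct monic irreducibles
are coprime, so the product stays separable. -/
theorem exists_separable_aeval_pi_eq_zero {K Ks X : Type*} [Field K] [Field Ks] [Algebra K Ks]
    [Algebra.IsSeparable K Ks] [Finite X] (y : X → Ks) :
    ∃ p : Polynomial K, p.Separable ∧ Polynomial.aeval y p = 0 := by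
  classical
  have := Fintype.ofFinite X
  let S : Finset (Polynomial K) := Finset.univ.image fun x => minpoly K (y x)
  have hq : ∀ q : S, ∃ x, minpoly K (y x) = q.1 := fun q => by
    obtain ⟨x, _, hx⟩ := Finset.mem_image.mp q.2
    exact ⟨x, hx⟩
  have hint : ∀ a : Ks, IsIntegral K a := Algebra.IsIntegral.isIntegral
  refine ⟨∏ q : S, q.1, Polynomial.separable_prod (fun q r hqr => ?_) fun q => ?_, ?_⟩
  · obtain ⟨a, ha⟩ := hq q
    obtain ⟨b, hb⟩ := hq r
    have hne : q.1 ≠ r.1 := fun h => hqr (Subtype.ext h)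
    change IsCoprime q.1 r.1
    rw [← ha, ← hb] at hne ⊢
    refine (minpoly.irreducible (hint _)).coprime_iff_not_dvd.mpr fun hd => hne ?_
    exact Polynomial.eq_of_monic_of_associated (minpoly.monic (hint _))
      (minpoly.monic (hint _)) ((minpoly.irreducible (hint _)).associated_of_dvd
        (minpoly.irreducible (hint _)) hd)
  · obtain ⟨a, ha⟩ := hq q
    rw [← ha]
    exact Algebra.IsSeparable.isSeparable K (y a)
  · funext x
    have hd : minpoly K (y x) ∣ ∏ q : S, q.1 :=
      Finset.dvd_prod_of_mem (fun q : S => q.1)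
        (Finset.mem_univ (⟨_, Finset.mem_image_of_mem _ (Finset.mem_univ x)⟩ : S))
    refine (Polynomial.aeval_algHom_apply (Pi.evalAlgHom K (fun _ : X => Ks) x) y _).symm.trans ?_
    obtain ⟨r, hr⟩ := hd
    rw [hr, map_mul]
    exact mul_eq_zero_of_left (minpoly.aeval _ _) _

/-- A finite subalgebra of a finite power of a separable extension is étale. -/
theorem etale_subalgebra_pi {K Ks X : Type*} [Field K] [Field Ks] [Algebra K Ks]
    [Algebra.IsSeparable K Ks] [Finite X] (L : Subalgebra K (X → Ks)) [Module.Finite K L] :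
    Algebra.Etale K L := by
  have : Algebra.FormallyUnramified K L := by
    refine formallyUnramified_of_forall_exists_separable fun y => ?_
    obtain ⟨p, hp, hpy⟩ := exists_separable_aeval_pi_eq_zero (K := K) y.1
    exact ⟨p, hp, Subtype.ext ((Polynomial.aeval_algHom_apply L.val y p).symm.trans hpy)⟩
  have := Algebra.FormallyEtale.of_formallyUnramified_of_field K L
  exact ⟨inferInstance, Algebra.FinitePresentation.of_finiteType.mp inferInstance⟩

/-! ## The pairing of a module of order three with the coordinates of its dual algebra -/

/-- A pairing of a set `C` of two elements with a group `M` of order three, with values in the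
cube roots of unity, for which the elements of `C` are the two nontrivial characters of `M`. -/
structure IsCubicPairing {Ks M C : Type*} [Field Ks] [AddCommGroup M] (χ : C → M → Ks) : Prop where
  map_add : ∀ ι x y, χ ι (x + y) = χ ι x * χ ι y
  exists_generators : ∃ (i j : C) (m : M) (ζ : Ks), i ≠ j ∧ (∀ ι, ι = i ∨ ι = j) ∧
    m ≠ 0 ∧ m + m ≠ 0 ∧ m + m ≠ m ∧ (∀ x, x = 0 ∨ x = m ∨ x = m + m) ∧
    ζ ^ 2 + ζ + 1 = 0 ∧ ζ ≠ 1 ∧ χ i m = ζ ∧ χ j m = ζ ^ 2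

namespace TateDual

variable {Ks M : Type*} [Field Ks] [AddCommGroup M]

theorem eval_add (f : TateDual Ks M) (x y : M) : f.eval (x + y) = f.eval x * f.eval y := by
  simp only [eval]
  erw [map_add, toMul_add]
  simp

theorem eval_zero (f : TateDual Ks M) : f.eval 0 = 1 := by
  simp only [eval]
  erw [map_zero]
  simp

theorem eval_zero_left (x : M) : (0 : TateDual Ks M).eval x = 1 := rfl

theorem eval_add_left (f f' : TateDual Ks M) (x : M) :
    (f + f').eval x = f.eval x * f'.eval x := rfl

theorem ext_eval {f f' : TateDual Ks M} (h : ∀ x, f.eval x = f'.eval x) : f = f' :=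
  AddMonoidHom.ext fun x => Subtype.ext (Units.ext (h x))

end TateDual

theorem sq_add_self_add_one_eq_zero {F : Type*} [Field F] {ζ : F} (h : IsPrimitiveRoot ζ 3) :
    ζ ^ 2 + ζ + 1 = 0 := by
  have h1 : ζ - 1 ≠ 0 := sub_ne_zero.mpr (h.ne_one (by norm_num))
  refine (mul_eq_zero.mp ?_).resolve_left h1
  linear_combination h.pow_eq_one

theorem eq_one_or_of_pow_three {F : Type*} [Field F] {ζ z : F} (hζ : ζ ^ 2 + ζ + 1 = 0)
    (hz : z ^ 3 = 1) : z = 1 ∨ z = ζ ∨ z = ζ ^ 2 := by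
  have h : (z - 1) * ((z - ζ) * (z - ζ ^ 2)) = 0 := by
    linear_combination hz + (z - z ^ 2 + (ζ - 1) * (z - 1)) * hζ
  rcases mul_eq_zero.mp h with h | h
  · exact .inl (sub_eq_zero.mp h)
  · exact .inr ((mul_eq_zero.mp h).imp sub_eq_zero.mp sub_eq_zero.mp)

/-- A character is determined by its value at a generator `m`, a cube root of unity. If `f` takes
the primitive value `ζ`, the nonzero characters are `f` and `f + f`; as the dual has exponent 3,
these are its elements of maximal order. -/
theorem isCubicPairing_eval {Ks M C : Type*} [Field Ks] [AddCommGroup M] [IsSepClosed Ks]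
    [NeZero (3 : Ks)] (hM : Nat.card M = 3) (e : C ≃ MaxOrder (TateDual Ks M)) :
    IsCubicPairing fun (ι : C) (x : M) => (e ι).1.eval x := by
  have hz : ∀ a : ZMod 3, a = 0 ∨ a = 1 ∨ a = 1 + 1 := by decide
  have hz1 : (1 : ZMod 3) ≠ 0 := by decide
  have hz2 : (1 + 1 : ZMod 3) ≠ 0 := by decide
  have : Fact (Nat.Prime 3) := ⟨Nat.prime_three⟩
  have := isAddCyclic_of_prime_card hM
  let φ : ZMod 3 ≃+ M := (ZMod.ringEquivCongr hM.symm).toAddEquiv.trans (zmodAddCyclicAddEquiv ‹_›)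
  let m : M := φ 1
  have hall : ∀ x, x = 0 ∨ x = m ∨ x = m + m := by
    intro x
    obtain ⟨a, rfl⟩ := φ.surjective x
    rw [← map_add, ← map_zero φ, φ.injective.eq_iff, φ.injective.eq_iff, φ.injective.eq_iff]
    exact hz a
  have hm0 : m ≠ 0 := by
    rw [← map_zero φ, Ne, φ.injective.eq_iff]
    exact hz1
  have hmm0 : m + m ≠ 0 := by
    rw [← map_zero φ, ← map_add, Ne, φ.injective.eq_iff]
    exact hz2
  have hmm : m + m ≠ m := by simpa using hm0
  have hex : AddMonoid.exponent M = 3 := by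
    rw [← hM]
    exact IsAddCyclic.exponent_eq_card
  obtain ⟨ζ, hζ⟩ := HasEnoughRootsOfUnity.exists_primitiveRoot Ks 3
  have hζ1 : ζ ≠ 1 := hζ.ne_one (by norm_num)
  have hζ2 := sq_add_self_add_one_eq_zero hζ
  have hev : ∀ (f : TateDual Ks M) (x : M), f.eval x ^ 3 = 1 := by
    intro f x
    have h := (Additive.toMul ((show M →+ Additive (rootsOfUnity (AddMonoid.exponent M) Ks)
      from f) x)).2
    rw [mem_rootsOfUnity] at h
    rw [← hex]
    exact congrArg Units.val h
  have hext : ∀ {f f' : TateDual Ks M}, f.eval m = f'.eval m → f = f' := by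
    intro f f' h
    refine TateDual.ext_eval fun x => ?_
    rcases hall x with rfl | rfl | rfl
    · rw [TateDual.eval_zero, TateDual.eval_zero]
    · exact h
    · rw [TateDual.eval_add, TateDual.eval_add, h]
  obtain ⟨f, hf⟩ : ∃ f : TateDual Ks M, f.eval m = ζ := by
    let u : rootsOfUnity (AddMonoid.exponent M) Ks :=
      haveI : NeZero (AddMonoid.exponent M) := ⟨by rw [hex]; norm_num⟩
      rootsOfUnity.mkOfPowEq ζ (by rw [hex]; exact hζ.pow_eq_one)
    have hu : (zmultiplesHom _ (Additive.ofMul u)) ((3 : ℕ) : ℤ) = 0 := by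
      have hu3 : u ^ 3 = 1 := by
        refine Subtype.ext ?_
        rw [← hex]
        exact u.2
      rw [zmultiplesHom_apply, natCast_zsmul, ← ofMul_pow, hu3, ofMul_one]
    refine ⟨(ZMod.lift 3 ⟨zmultiplesHom _ (Additive.ofMul u), hu⟩).comp φ.symm.toAddMonoidHom, ?_⟩
    have h1 : (ZMod.lift 3 ⟨zmultiplesHom _ (Additive.ofMul u), hu⟩) (1 : ZMod 3)
        = Additive.ofMul u := by
      have := ZMod.lift_coe 3 ⟨zmultiplesHom _ (Additive.ofMul u), hu⟩ 1
      simpa using this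
    have h2 : φ.symm m = 1 := φ.symm_apply_apply 1
    simp only [TateDual.eval]
    erw [AddMonoidHom.comp_apply]
    change ((Additive.toMul (ZMod.lift 3 _ (φ.symm m)) : rootsOfUnity _ Ks) : Ksˣ).val = ζ
    rw [h2, h1]
    rfl
  have hff : (f + f).eval m = ζ ^ 2 := by rw [TateDual.eval_add_left, hf, sq]
  have hne : ∀ {d : TateDual Ks M}, d.eval m ≠ 1 → d ≠ 0 := by
    rintro _ h rfl
    exact h (TateDual.eval_zero_left m)
  have h3 : ∀ d : TateDual Ks M, 3 • d = 0 := by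
    intro d
    refine TateDual.ext_eval fun x => ?_
    rw [show 3 • d = d + d + d by abel, TateDual.eval_add_left, TateDual.eval_add_left,
      TateDual.eval_zero_left, ← hev d x]
    ring
  have hord : ∀ {d : TateDual Ks M}, d ≠ 0 → addOrderOf d = 3 := fun hd =>
    addOrderOf_eq_prime (h3 _) hd
  have hf0 : f ≠ 0 := hne (hf ▸ hζ1)
  have hζ21 : ζ ^ 2 ≠ 1 := hζ.pow_ne_one_of_pos_of_lt (by norm_num) (by norm_num)
  have hff0 : f + f ≠ 0 := hne (hff ▸ hζ21)
  have hexd : AddMonoid.exponent (TateDual Ks M) = 3 := by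
    have hnt : Nontrivial (TateDual Ks M) := ⟨f, 0, hf0⟩
    exact (AddMonoid.exponent_eq_prime_iff Nat.prime_three).mpr fun d hd => hord hd
  let I : MaxOrder (TateDual Ks M) := ⟨f, (hord hf0).trans hexd.symm⟩
  let J : MaxOrder (TateDual Ks M) := ⟨f + f, (hord hff0).trans hexd.symm⟩
  refine ⟨fun ι x y => TateDual.eval_add _ x y, e.symm I, e.symm J, m, ζ, ?_, ?_, hm0, hmm0, hmm, hall, hζ2, hζ1,
    ?_, ?_⟩
  · intro h
    have := congrArg Subtype.val (e.symm.injective h)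
    exact hf0 (left_eq_add.mp this)
  · intro ι
    rw [e.eq_symm_apply, e.eq_symm_apply]
    have hι : (e ι).1 ≠ 0 := by
      intro h
      have := (e ι).2
      rw [h, addOrderOf_zero, hexd] at this
      norm_num at this
    rcases eq_one_or_of_pow_three hζ2 (hev (e ι).1 m) with h | h | h
    · exact absurd (hext (h.trans (TateDual.eval_zero_left m).symm)) hι
    · exact .inl (Subtype.ext (hext (h.trans hf.symm)))
    · exact .inr (Subtype.ext (hext (h.trans hff.symm)))
  · rw [e.apply_symm_apply]
    exact hf
  · rw [e.apply_symm_apply]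
    exact hff

theorem univ_eq_pair {C : Type*} [Fintype C] [DecidableEq C] {i j : C} (hC : ∀ ι, ι = i ∨ ι = j) :
    (Finset.univ : Finset C) = {i, j} := by
  ext x
  simpa using hC x

theorem sum_eq_add_of_forall {C R : Type*} [Fintype C] [AddCommMonoid R] {i j : C} (hij : i ≠ j)
    (hC : ∀ ι, ι = i ∨ ι = j) (F : C → R) : ∑ ι, F ι = F i + F j := by
  classical
  rw [univ_eq_pair hC, Finset.sum_pair hij]

theorem prod_eq_mul_of_forall {C R : Type*} [Fintype C] [CommMonoid R] {i j : C} (hij : i ≠ j)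
    (hC : ∀ ι, ι = i ∨ ι = j) (F : C → R) : ∏ ι, F ι = F i * F j := by
  classical
  rw [univ_eq_pair hC, Finset.prod_pair hij]

/-! ### Duality and Fourier analysis on a group of order three -/

namespace IsCubicPairing

variable {Ks M C : Type*} [Field Ks] [AddCommGroup M] {χ : C → M → Ks}

theorem finite_left (h : IsCubicPairing χ) : Finite C := by
  obtain ⟨i, j, -, -, -, hC, -⟩ := h.exists_generators
  exact Set.finite_univ_iff.mp (Set.Finite.subset (Set.toFinite {i, j}) fun x _ => hC x)

theorem finite_right (h : IsCubicPairing χ) : Finite M := by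
  obtain ⟨-, -, m, -, -, -, -, -, -, hM, -⟩ := h.exists_generators
  exact Set.finite_univ_iff.mp (Set.Finite.subset (Set.toFinite {0, m, m + m}) fun x _ => hM x)

theorem card_right (h : IsCubicPairing χ) : Nat.card M = 3 := by
  classical
  have := h.finite_right
  have := Fintype.ofFinite M
  obtain ⟨-, -, m, -, -, -, hm0, hmm0, hmm, hM, -⟩ := h.exists_generators
  have : (Finset.univ : Finset M) = {0, m, m + m} := by
    ext x
    simpa using hM x
  rw [Nat.card_eq_fintype_card, ← Finset.card_univ, this,
    Finset.card_insert_of_notMem (by simp [hm0.symm, hmm0.symm]), Finset.card_pair hmm.symm]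

theorem card_left (h : IsCubicPairing χ) : Nat.card C = 2 := by
  classical
  have := h.finite_left
  have := Fintype.ofFinite C
  obtain ⟨i, j, -, -, hij, hC, -⟩ := h.exists_generators
  rw [Nat.card_eq_fintype_card, ← Finset.card_univ, univ_eq_pair hC, Finset.card_pair hij]

theorem ne_zero (h : IsCubicPairing χ) (ι : C) (x : M) : χ ι x ≠ 0 := by
  obtain ⟨i, j, m, ζ, -, hC, -, -, -, hM, hζ, -, hi, hj⟩ := h.exists_generators
  have hζ0 : ζ ≠ 0 := by
    rintro rfl
    norm_num at hζ
  have hm : χ ι m ≠ 0 := by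
    rcases hC ι with rfl | rfl
    · rwa [hi]
    · rw [hj]
      exact pow_ne_zero 2 hζ0
  have h0 : χ ι 0 ≠ 0 := fun h0 => hm (by rw [← add_zero m, h.map_add, h0, mul_zero])
  rcases hM x with rfl | rfl | rfl
  · exact h0
  · exact hm
  · rw [h.map_add]
    exact mul_ne_zero hm hm

theorem map_zero (h : IsCubicPairing χ) (ι : C) : χ ι 0 = 1 := by
  have h0 := h.map_add ι 0 0
  rw [add_zero] at h0
  exact (mul_eq_left₀ (h.ne_zero ι 0)).mp h0.symm

theorem map_neg (h : IsCubicPairing χ) (ι : C) (x : M) : χ ι (-x) = (χ ι x)⁻¹ := by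
  refine eq_inv_of_mul_eq_one_left ?_
  rw [← h.map_add, neg_add_cancel, h.map_zero]

theorem map_sub (h : IsCubicPairing χ) (ι : C) (x y : M) : χ ι (x - y) = χ ι x / χ ι y := by
  rw [sub_eq_add_neg, h.map_add, h.map_neg, div_eq_mul_inv]

theorem pow_three (h : IsCubicPairing χ) (ι : C) (x : M) : χ ι x ^ 3 = 1 := by
  have h3 : x + x + x = 0 := by
    have := card_nsmul_eq_zero' (x := x)
    rwa [h.card_right, succ_nsmul, two_nsmul] at this
  rw [← h.map_zero ι, ← h3, h.map_add, h.map_add]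
  ring

theorem prod_eq_one (h : IsCubicPairing χ) [Fintype C] (x : M) : ∏ ι, χ ι x = 1 := by
  obtain ⟨i, j, m, ζ, hij, hC, -, -, -, hM, hζ, -, hi, hj⟩ := h.exists_generators
  have hm : χ i m * χ j m = 1 := by
    rw [hi, hj]
    linear_combination (ζ - 1) * hζ
  rw [prod_eq_mul_of_forall hij hC]
  rcases hM x with rfl | rfl | rfl
  · rw [h.map_zero, h.map_zero, one_mul]
  · exact hm
  · rw [h.map_add, h.map_add, mul_mul_mul_comm, hm, one_mul]

theorem injective (h : IsCubicPairing χ) (ι : C) : Function.Injective (χ ι) := by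
  obtain ⟨i, j, m, ζ, -, hC, -, -, -, hM, hζ, hζ1, hi, hj⟩ := h.exists_generators
  have hm : χ ι m ≠ 1 := by
    rcases hC ι with rfl | rfl
    · rwa [hi]
    · rw [hj]
      intro h1
      apply hζ1
      linear_combination (ζ - 1) * hζ - ζ * h1
  have key : ∀ x, χ ι x = 1 → x = 0 := by
    intro x hx
    rcases hM x with rfl | rfl | rfl
    · rfl
    · exact absurd hx hm
    · refine absurd ?_ hm
      have h3 := h.pow_three ι m
      rw [h.map_add] at hx
      linear_combination h3 - χ ι m * hx
  intro x y hxy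
  refine sub_eq_zero.mp (key _ ?_)
  rw [h.map_sub, hxy, div_self (h.ne_zero ι y)]

/-- The entry at `i` is 1, `ζ` or `ζ²`, attained at 0, `m` or `m + m`; the product condition then
fixes the other entry. -/
theorem exists_eq (h : IsCubicPairing χ) [Fintype C] {ω : C → Ks} (hω : ω ^ 3 = 1)
    (hN : ∏ ι, ω ι = 1) : ∃ x, ∀ ι, χ ι x = ω ι := by
  obtain ⟨i, j, m, ζ, hij, hC, -, -, -, hM, hζ, hζ1, hi, hj⟩ := h.exists_generators
  have hi0 : ω i ≠ 0 := by
    intro h0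
    rw [prod_eq_mul_of_forall hij hC, h0, zero_mul] at hN
    exact zero_ne_one hN
  obtain ⟨x, hx⟩ : ∃ x, χ i x = ω i := by
    rcases eq_one_or_of_pow_three hζ (congrFun hω i) with h1 | h1 | h1
    · exact ⟨0, by rw [h.map_zero, h1]⟩
    · exact ⟨m, by rw [hi, h1]⟩
    · exact ⟨m + m, by rw [h.map_add, hi, h1, sq]⟩
  refine ⟨x, fun ι => ?_⟩
  rcases hC ι with rfl | rfl
  · exact hx
  · have h1 := h.prod_eq_one x
    rw [prod_eq_mul_of_forall hij hC] at hN h1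
    rw [hx, ← hN] at h1
    exact mul_left_cancel₀ hi0 h1

/-- Orthogonality of characters; the summand 1 is the trivial character, which has no index in `C`.
-/
theorem one_add_sum (h : IsCubicPairing χ) [Fintype C] [DecidableEq M] (x : M) :
    1 + ∑ ι, χ ι x = if x = 0 then 3 else 0 := by
  obtain ⟨i, j, m, ζ, hij, hC, hm0, hmm0, -, hM, hζ, -, hi, hj⟩ := h.exists_generators
  rw [sum_eq_add_of_forall hij hC]
  rcases hM x with rfl | rfl | rfl
  · rw [h.map_zero, h.map_zero, if_pos rfl]
    norm_num
  · rw [if_neg hm0, hi, hj]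
    linear_combination hζ
  · rw [if_neg hmm0, h.map_add, h.map_add, hi, hj]
    linear_combination (ζ ^ 2 - ζ + 1) * hζ

/-- Fourier inversion on a group of order three. -/
theorem fourier_inversion (h : IsCubicPairing χ) [Fintype C] [Fintype M] (y : M → Ks) (x : M) :
    3 * y x = ∑ z, y z + ∑ ι, (∑ z, χ ι (-z) * y z) * χ ι x := by
  classical
  have h1 : ∑ ι, (∑ z, χ ι (-z) * y z) * χ ι x = ∑ z, (∑ ι, χ ι (x - z)) * y z := by
    simp only [Finset.sum_mul]
    rw [Finset.sum_comm]
    refine Finset.sum_congr rfl fun z _ => Finset.sum_congr rfl fun ι _ => ?_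
    rw [sub_eq_add_neg, h.map_add]
    ring
  rw [h1, ← Finset.sum_add_distrib, Finset.sum_eq_single x]
  · have h2 := h.one_add_sum (x - x)
    rw [if_pos (sub_self x)] at h2
    linear_combination (-y x) * h2
  · intro z _ hz
    have h2 := h.one_add_sum (x - z)
    rw [if_neg (sub_ne_zero.mpr hz.symm)] at h2
    linear_combination y z * h2
  · exact fun hx => absurd (Finset.mem_univ x) hx

/-- Weighting the three equations by the inverse values of a character isolates 3 times its
coefficient. -/
theorem eq_zero_of_forall (h : IsCubicPairing χ) [Fintype C] (h3 : (3 : Ks) ≠ 0) {a : Ks}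
    {b : C → Ks} (hab : ∀ x, a + ∑ ι, b ι * χ ι x = 0) : a = 0 ∧ b = 0 := by
  obtain ⟨i, j, m, ζ, hij, hC, hm0, hmm0, hmm, hM, hζ, hζ1, hi, hj⟩ := h.exists_generators
  simp only [sum_eq_add_of_forall hij hC (fun ι => b ι * _)] at hab
  have e0 := hab 0
  have e1 := hab m
  have e2 := hab (m + m)
  rw [h.map_zero, h.map_zero] at e0
  rw [hi, hj] at e1
  rw [h.map_add, h.map_add, hi, hj] at e2
  refine ⟨(mul_eq_zero.mp ?_).resolve_left h3, funext fun ι =>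
    (mul_eq_zero.mp ?_).resolve_left h3⟩
  · linear_combination e0 + e1 + e2 - (b i + b j * (ζ ^ 2 - ζ + 1)) * hζ
  · rcases hC ι with rfl | rfl
    · linear_combination e0 + ζ ^ 2 * e1 + ζ * e2
        - (a + 2 * b ι * (ζ - 1) + b j * (ζ ^ 3 - ζ + 1)) * hζ
    · linear_combination e0 + ζ * e1 + ζ ^ 2 * e2
        - (a + b i * (ζ ^ 2 - ζ + 1) + b ι * ((ζ - 1) * (ζ ^ 3 + 2))) * hζ

end IsCubicPairing

/-! ## Kummer theory for a module of order three -/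

theorem exists_eq_mul_of_pow_three_eq {Ks M C : Type*} [Field Ks] [AddCommGroup M]
    {χ : C → M → Ks} (hχ : IsCubicPairing χ) [Fintype C] {θ θ' : C → Ks} (h3 : θ' ^ 3 = θ ^ 3) (hN : ∏ ι, θ ι = 1) (hN' : ∏ ι, θ' ι = 1) :
    ∃ u : M, ∀ ι, θ' ι = χ ι u * θ ι := by
  have hne : ∀ ι, θ ι ≠ 0 := fun ι =>
    Finset.prod_ne_zero_iff.mp (hN ▸ one_ne_zero) ι (Finset.mem_univ ι)
  obtain ⟨u, hu⟩ := hχ.exists_eq (ω := fun ι => θ' ι / θ ι)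
    (funext fun ι => by
      have := congrFun h3 ι
      simp only [Pi.pow_apply] at this
      simp only [Pi.pow_apply, div_pow, this, Pi.one_apply]
      exact div_self (pow_ne_zero 3 (hne ι)))
    (by rw [Finset.prod_div_distrib, hN, hN', div_one])
  exact ⟨u, fun ι => by rw [hu, div_mul_cancel₀ _ (hne ι)]⟩

section Kummer

variable {K Ks T M : Type*} [Field K] [Field Ks] [Algebra K Ks] [CommRing T] [Algebra K T]
  [AddCommGroup M] [DistribMulAction Gal(Ks/K) M]

/-- Compatibility of a pairing with the Galois actions. -/
def IsEquivariant (χ : Coord K Ks T → M → Ks) : Prop :=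
  ∀ (g : Gal(Ks/K)) (ι : Coord K Ks T) (x : M), χ (g • ι) (g • x) = g (χ ι x)

/-- The function `c` describes the Galois action on `θ`: one has `g θ = c(g) θ`, where `M` is
embedded in `Ksⁿ` by the pairing `χ`. -/
def IsKummerCocycle (χ : Coord K Ks T → M → Ks) (θ : Coord K Ks T → Ks) (c : Gal(Ks/K) → M) :
    Prop :=
  ∀ (g : Gal(Ks/K)) (ι : Coord K Ks T), g (θ ι) = χ (g • ι) (c g) * θ (g • ι)

theorem isOpen_setOf_smul_coord_eq [Algebra.IsIntegral K Ks] [Module.Finite K T]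
    [Finite (Coord K Ks T)] :
    IsOpen {g : Gal(Ks/K) | ∀ ι : Coord K Ks T, g • ι = ι} := by
  let b := Module.finBasis K T
  have h : {g : Gal(Ks/K) | ∀ ι : Coord K Ks T, g • ι = ι}
      = ⋂ (ι : Coord K Ks T), ⋂ j, (MulAction.stabilizer Gal(Ks/K) (ι (b j)) : Set _) := by
    ext g
    simp only [Set.mem_ofPred_eq, Set.mem_iInter, SetLike.mem_coe, MulAction.mem_stabilizer_iff]
    refine forall_congr' fun ι => ⟨fun hg j => ?_, fun hg => ?_⟩
    · exact DFunLike.congr_fun hg (b j)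
    · have := b.ext (f₁ := (g • ι).toLinearMap) (f₂ := ι.toLinearMap) hg
      exact AlgHom.ext fun x => DFunLike.congr_fun this x
  rw [h]
  exact isOpen_iInter_of_finite fun ι => isOpen_iInter_of_finite fun j =>
    stabilizer_isOpen_of_isIntegral _

/-- Changing the cube root by an element of `M` changes the cocycle by its coboundary, so the class
depends on `δ` alone. -/
theorem IsKummerCocycle.eq_add {χ : Coord K Ks T → M → Ks} (hχ : IsCubicPairing χ) (heq : IsEquivariant χ)
    {θ θ' : Coord K Ks T → Ks} {c c' : Gal(Ks/K) → M} (h : IsKummerCocycle χ θ c)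
    (h' : IsKummerCocycle χ θ' c') (hne : ∀ ι, θ ι ≠ 0) {u : M}
    (hu : ∀ ι, θ' ι = χ ι u * θ ι) (g : Gal(Ks/K)) : c' g = c g + (g • u - u) := by
  rw [← add_sub_assoc, eq_sub_iff_add_eq]
  obtain ⟨i, -⟩ := hχ.exists_generators
  apply hχ.injective (g • i)
  apply mul_right_cancel₀ (hne (g • i))
  have h1 := h' g i
  rw [hu, hu, map_mul, ← heq, h g] at h1
  rw [hχ.map_add, hχ.map_add]
  linear_combination -h1

variable [TopologicalSpace M] [DiscreteTopology M] {χ : Coord K Ks T → M → Ks}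

/-- A crossed homomorphism which vanishes near `1` is continuous. -/
theorem continuous_of_crossedHom {c : Gal(Ks/K) → M} (hc : ∀ g h, c (g * h) = c g + g • c h)
    {U : Set Gal(Ks/K)} (hU : IsOpen U) (h1 : 1 ∈ U) (h0 : ∀ u ∈ U, c u = 0) : Continuous c := by
  rw [continuous_discrete_rng]
  intro b
  rw [isOpen_iff_mem_nhds]
  intro g hg
  have hmem : (fun h => g⁻¹ * h) ⁻¹' U ∈ nhds g :=
    (hU.preimage (continuous_const_mul g⁻¹)).mem_nhds (by simpa using h1)
  filter_upwards [hmem] with h hh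
  have := hc g (g⁻¹ * h)
  rw [mul_inv_cancel_left, h0 _ hh, smul_zero, add_zero] at this
  exact this.trans hg

/-- The quotient `gθ/θ` is a cube root of unity because `g` fixes `δ`, and has norm one because `g`
only permutes the conjugated entries; hence it lies in `M`. -/
theorem exists_isKummerCocycle (hχ : IsCubicPairing χ) (heq : IsEquivariant χ)
    [Algebra.IsIntegral K Ks] [Module.Finite K T] [Fintype (Coord K Ks T)] {δ : T}
    {θ : Coord K Ks T → Ks} (hθ : θ ^ 3 = minkowski K Ks T δ) (hN : ∏ ι, θ ι = 1) :
    ∃ c : Z1 Gal(Ks/K) M, IsKummerCocycle χ θ c := by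
  have hne : ∀ ι, θ ι ≠ 0 := fun ι =>
    Finset.prod_ne_zero_iff.mp (hN ▸ one_ne_zero) ι (Finset.mem_univ ι)
  have hex : ∀ g : Gal(Ks/K), ∃ x, ∀ ι, χ ι x = g (θ (g⁻¹ • ι)) / θ ι := by
    intro g
    refine hχ.exists_eq (ω := fun ι => g (θ (g⁻¹ • ι)) / θ ι) (funext fun ι => ?_) ?_
    · have h1 : g (θ (g⁻¹ • ι)) ^ 3 = θ ι ^ 3 := by
        have h2 : ∀ ι, θ ι ^ 3 = ι δ := fun ι => congrFun hθ ι
        rw [← map_pow, h2, h2, ← smul_coord_apply, smul_inv_smul]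
      simp only [Pi.pow_apply, div_pow, h1, Pi.one_apply]
      exact div_self (pow_ne_zero 3 (hne ι))
    · rw [Finset.prod_div_distrib, hN, div_one,
        ← map_one g, ← hN, map_prod]
      exact Equiv.prod_comp (MulAction.toPerm g⁻¹) fun ι => g (θ ι)
  choose c hc using hex
  have hk : IsKummerCocycle χ θ c := by
    intro g ι
    rw [hc, inv_smul_smul, div_mul_cancel₀ _ (hne _)]
  have hcr : ∀ g h, c (g * h) = c g + g • c h := by
    intro g h
    obtain ⟨i, -⟩ := hχ.exists_generators
    apply hχ.injective ((g * h) • i)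
    apply mul_right_cancel₀ (hne ((g * h) • i))
    rw [← hk, AlgEquiv.mul_apply, hk h, map_mul, hk g, ← heq, hχ.map_add, mul_smul]
    ring
  refine ⟨⟨c, ?_, hcr⟩, hk⟩
  -- On this neighbourhood of 1 the coordinates and the entries of `θ` are all fixed, so the cocycle
  -- vanishes.
  let U : Set Gal(Ks/K) := {g | ∀ ι : Coord K Ks T, g • ι = ι} ∩
    ⋂ ι, (MulAction.stabilizer Gal(Ks/K) (θ ι) : Set _)
  have hU : IsOpen U := isOpen_setOf_smul_coord_eq.inter
    (isOpen_iInter_of_finite fun ι => stabilizer_isOpen_of_isIntegral _)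
  refine continuous_of_crossedHom hcr hU ⟨fun ι => one_smul _ ι, ?_⟩ fun u hu => ?_
  · exact Set.mem_iInter.mpr fun ι => one_mem _
  · obtain ⟨i, -⟩ := hχ.exists_generators
    apply hχ.injective i
    have h1 := hk u i
    have h2 : u (θ i) = θ i := Set.mem_iInter.mp hu.2 i
    rw [hu.1 i, h2] at h1
    rw [hχ.map_zero]
    exact (mul_eq_right₀ (hne i)).mp h1.symm

/-- Hilbert's theorem 90 for the twist of the group `(Ksⁿ)ˣ` by a cocycle with values in `M`. -/
theorem exists_twisted_invariant [IsGalois K Ks] [Module.Finite K T] (hχ : IsCubicPairing χ)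
    (heq : IsEquivariant χ) (σ : Z1 Gal(Ks/K) M) :
    ∃ η : Coord K Ks T → Ks, (∀ ι, η ι ≠ 0) ∧
      ∀ (h : Gal(Ks/K)) ι, h (η ι) = χ (h • ι) (-(σ : Gal(Ks/K) → M) h) * η (h • ι) := by
  classical
  have := hχ.finite_left
  obtain ⟨s, hσ, hcr⟩ := σ
  change ∃ η : Coord K Ks T → Ks, (∀ ι, η ι ≠ 0) ∧
      ∀ (h : Gal(Ks/K)) ι, h (η ι) = χ (h • ι) (-s h) * η (h • ι)
  have hs1 : s 1 = 0 := by simpa using hcr 1 1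
  have hU : IsOpen ({g : Gal(Ks/K) | ∀ ι : Coord K Ks T, g • ι = ι} ∩ s ⁻¹' {0}) :=
    isOpen_setOf_smul_coord_eq.inter (hσ.isOpen_preimage _ (isOpen_discrete _))
  -- `E` is finite over `K`, and its fixing subgroup `N` acts trivially on the coordinates and kills
  -- `s`. `N` need not be normal: only left cosets are used.
  obtain ⟨E, hE, hEU⟩ := (krullTopology_mem_nhds_one_iff K Ks _).mp
    (hU.mem_nhds ⟨fun ι => one_smul _ ι, hs1⟩)
  let N := E.fixingSubgroup
  have : Finite (Gal(Ks/K) ⧸ N) :=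
    Subgroup.quotient_finite_of_isOpen N (IntermediateField.fixingSubgroup_isOpen E)
  have := Fintype.ofFinite (Gal(Ks/K) ⧸ N)
  let F (a : Coord K Ks T → E) (ι : Coord K Ks T) (g : Gal(Ks/K)) : Ks :=
    χ ι (s g) * g (a (g⁻¹ • ι) : Ks)
  have hF : ∀ a ι (g g' : Gal(Ks/K)), (g : Gal(Ks/K) ⧸ N) = g' → F a ι g = F a ι g' := by
    intro a ι g g' hgg
    obtain ⟨n, hn, rfl⟩ : ∃ n ∈ N, g' = g * n := ⟨g⁻¹ * g', QuotientGroup.eq.mp hgg, by group⟩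
    have h1 := hEU hn
    have h2 : n⁻¹ • g⁻¹ • ι = g⁻¹ • ι := (hEU (inv_mem hn)).1 _
    have h3 : s n = 0 := h1.2
    have h4 : n (a (g⁻¹ • ι) : Ks) = a (g⁻¹ • ι) := hn _
    simp only [F]
    rw [hcr, h3, smul_zero, add_zero, mul_inv_rev, mul_smul, h2, AlgEquiv.mul_apply, h4]
  -- The Poincaré series `∑ s(g)·g(a)`; by `hF` its terms depend only on the coset, so translation
  -- by `h` permutes them.
  let η (a : Coord K Ks T → E) (ι : Coord K Ks T) : Ks := ∑ q : Gal(Ks/K) ⧸ N, F a ι q.out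
  have hη : ∀ a (h : Gal(Ks/K)) ι, h (η a ι) = χ (h • ι) (-s h) * η a (h • ι) := by
    intro a h ι
    simp only [η, map_sum]
    rw [← Equiv.sum_comp (MulAction.toPerm h)
      fun q : Gal(Ks/K) ⧸ N => F a (h • ι) q.out, Finset.mul_sum]
    refine Finset.sum_congr rfl fun q _ => ?_
    have h1 : F a (h • ι) (h • q).out = F a (h • ι) (h * q.out) := hF _ _ _ _ <| by
      rw [QuotientGroup.out_eq', ← smul_eq_mul, ← MulAction.Quotient.smul_coe,
        QuotientGroup.out_eq']
    rw [MulAction.toPerm_apply, h1]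
    simp only [F]
    rw [map_mul, ← heq, mul_inv_rev, mul_smul, inv_smul_smul, AlgEquiv.mul_apply, hcr, hχ.map_add,
      ← mul_assoc, ← mul_assoc, hχ.map_neg, inv_mul_cancel₀ (hχ.ne_zero _ _), one_mul]
  have hadd : ∀ a b ι, η (a + b) ι = η a ι + η b ι := by
    intro a b ι
    simp only [η, F, ← Finset.sum_add_distrib, Pi.add_apply, ← mul_add]
    refine Finset.sum_congr rfl fun q _ => ?_
    rw [← map_add]
    rfl
  let f (q : Gal(Ks/K) ⧸ N) : E →* Ks := (q.out.toAlgHom.comp E.val : E →* Ks)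
  have hf : Function.Injective f := by
    intro q q' hqq
    rw [← QuotientGroup.out_eq' q, ← QuotientGroup.out_eq' q']
    refine QuotientGroup.eq.mpr fun x => ?_
    have h1 : q.out (x : Ks) = q'.out (x : Ks) := DFunLike.congr_fun hqq x
    change (q.out⁻¹ * q'.out) (x : Ks) = x
    rw [AlgEquiv.mul_apply, ← h1, ← AlgEquiv.mul_apply, inv_mul_cancel, AlgEquiv.one_apply]
  -- For `a` supported at `ι` only cosets fixing `ι` contribute. Distinct cosets embed `E`
  -- differently, so Dedekind independence applies, and the trivial coset has coefficient 1.
  have hnz : ∀ ι, ∃ a, η a ι ≠ 0 := by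
    intro ι
    by_contra! hall
    have hlin := Fintype.linearIndependent_iff.mp ((linearIndependent_monoidHom E Ks).comp f hf)
      (fun q => if q.out⁻¹ • ι = ι then χ ι (s q.out) else 0) (funext fun x => by
        refine Eq.trans ?_ (hall (Pi.single ι x))
        simp only [η, F, Finset.sum_apply]
        refine Finset.sum_congr rfl fun q _ => ?_
        by_cases hq : q.out⁻¹ • ι = ι
        · simp only [hq, if_true, Pi.single_eq_same]
          rfl
        · simp [hq])
      ((1 : Gal(Ks/K)) : Gal(Ks/K) ⧸ N)
    have h1 : ((1 : Gal(Ks/K)) : Gal(Ks/K) ⧸ N).out ∈ N := by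
      have := QuotientGroup.eq.mp (QuotientGroup.out_eq' ((1 : Gal(Ks/K)) : Gal(Ks/K) ⧸ N)).symm
      simpa using this
    have h2 : s ((1 : Gal(Ks/K)) : Gal(Ks/K) ⧸ N).out = 0 := (hEU h1).2
    rw [if_pos ((hEU (inv_mem h1)).1 ι), h2, hχ.map_zero] at hlin
    exact one_ne_zero hlin
  obtain ⟨i, j, -, -, -, hC, -⟩ := hχ.exists_generators
  -- If each of two vectors works at one coordinate only, their sum works at both.
  obtain ⟨a, hai, haj⟩ : ∃ a, η a i ≠ 0 ∧ η a j ≠ 0 := by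
    obtain ⟨a, ha⟩ := hnz i
    obtain ⟨b, hb⟩ := hnz j
    by_cases haj : η a j = 0
    · by_cases hbi : η b i = 0
      · exact ⟨a + b, by rwa [hadd, hbi, add_zero], by rwa [hadd, haj, zero_add]⟩
      · exact ⟨b, hbi, hb⟩
    · exact ⟨a, ha, haj⟩
  exact ⟨η a, fun ι => by rcases hC ι with rfl | rfl <;> assumption, hη a⟩

end Kummer

/-! ### The Kummer isomorphism for norm-one units -/

section KummerIsomorphism

variable {K Ks T M : Type*} [Field K] [Field Ks] [Algebra K Ks] [CommRing T] [Algebra K T]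

theorem prod_coord_eq_one [IsSepClosed Ks] [Algebra.Etale K T] [Fintype (Coord K Ks T)]
    (δ : NormOne K T) : ∏ ι : Coord K Ks T, ι ((δ : Tˣ) : T) = 1 := by
  have h1 : Algebra.norm K ((δ : Tˣ) : T) = 1 := congrArg Units.val δ.2
  have h2 := norm_minkowski (K := K) (Ks := Ks) ((δ : Tˣ) : T)
  rwa [h1, map_one, norm_pi] at h2

theorem exists_cube_root [IsSepClosed Ks] [NeZero (3 : Ks)] [Algebra.Etale K T]
    [Fintype (Coord K Ks T)] (i : Coord K Ks T) (δ : NormOne K T) :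
    ∃ θ : Coord K Ks T → Ks, θ ^ 3 = minkowski K Ks T ((δ : Tˣ) : T) ∧ ∏ ι, θ ι = 1 := by
  classical
  have hz3 : NeZero ((3 : ℕ) : Ks) := ⟨by exact_mod_cast NeZero.ne (3 : Ks)⟩
  choose r hr using fun ι : Coord K Ks T => IsSepClosed.exists_pow_nat_eq (ι ((δ : Tˣ) : T)) 3
  have hz : (∏ ι, r ι) ^ 3 = 1 := by
    rw [← Finset.prod_pow, ← prod_coord_eq_one δ]
    exact Finset.prod_congr rfl fun ι _ => hr ι
  have hz0 : ∏ ι, r ι ≠ 0 := by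
    intro h
    simp [h] at hz
  -- The product of the chosen roots is a cube root of 1, so dividing it out at one coordinate
  -- preserves the cube.
  refine ⟨r * Pi.mulSingle i (∏ ι, r ι)⁻¹, ?_, ?_⟩
  · rw [mul_pow, ← Pi.mulSingle_pow, inv_pow, hz, inv_one, Pi.mulSingle_one, mul_one]
    exact funext hr
  · simp only [Pi.mul_apply, Finset.prod_mul_distrib, Finset.prod_pi_mulSingle',
      Finset.mem_univ, if_true]
    exact mul_inv_cancel₀ hz0

/-- An equivariant vector of product one comes from a unit of norm one. -/
theorem exists_normOne_minkowski_eq [IsSepClosure K Ks] [Algebra.Etale K T]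
    [Fintype (Coord K Ks T)] {v : Coord K Ks T → Ks}
    (hv : ∀ (g : Gal(Ks/K)) ι, g (v ι) = v (g • ι)) (hN : ∏ ι, v ι = 1) :
    ∃ t : NormOne K T, minkowski K Ks T ((t : Tˣ) : T) = v := by
  have : IsSepClosed Ks := IsSepClosure.sep_closed K
  obtain ⟨t, ht⟩ := exists_minkowski_eq hv
  have hne : ∀ ι, v ι ≠ 0 := fun ι =>
    Finset.prod_ne_zero_iff.mp (hN ▸ one_ne_zero) ι (Finset.mem_univ ι)
  obtain ⟨s, hs⟩ : ∃ s : T, minkowski K Ks T s = v⁻¹ :=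
    exists_minkowski_eq fun g ι => by simp only [Pi.inv_apply, map_inv₀, hv]
  have hts : t * s = 1 := by
    apply minkowski_injective (K := K) (Ks := Ks)
    rw [map_mul, ht, hs, map_one]
    exact funext fun ι => mul_inv_cancel₀ (hne ι)
  refine ⟨⟨Units.mkOfMulEqOne t s hts, ?_⟩, ht⟩
  rw [MonoidHom.mem_ker]
  refine Units.ext ((algebraMap K Ks).injective ?_)
  change algebraMap K Ks (Algebra.norm K t) = algebraMap K Ks 1
  rw [← norm_minkowski, ht, norm_pi, hN, map_one]

variable [AddCommGroup M] [DistribMulAction Gal(Ks/K) M] [TopologicalSpace M] [DiscreteTopology M]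
  {χ : Coord K Ks T → M → Ks}

/-- The cocycle `c` is the Kummer cocycle of a cube root of norm one of `δ`. -/
def IsKummerClass [Fintype (Coord K Ks T)] (χ : Coord K Ks T → M → Ks) (δ : NormOne K T)
    (c : Z1 Gal(Ks/K) M) : Prop :=
  ∃ θ : Coord K Ks T → Ks, θ ^ 3 = minkowski K Ks T ((δ : Tˣ) : T) ∧ ∏ ι, θ ι = 1 ∧
    IsKummerCocycle χ θ c

theorem H1_mk_eq_iff {c c' : Z1 Gal(Ks/K) M} :
    (QuotientAddGroup.mk c : H1 Gal(Ks/K) M) = QuotientAddGroup.mk c' ↔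
      ∃ u : M, ∀ g, (c' : Gal(Ks/K) → M) g = (c : Gal(Ks/K) → M) g + (g • u - u) := by
  rw [QuotientAddGroup.eq]
  refine exists_congr fun u => forall_congr' fun g => ?_
  rw [← sub_eq_iff_eq_add', AddSubgroup.coe_add, AddSubgroup.coe_neg, Pi.add_apply, Pi.neg_apply,
    neg_add_eq_sub]

theorem IsKummerClass.mk_eq [Fintype (Coord K Ks T)] (hχ : IsCubicPairing χ)
    (heq : IsEquivariant χ) {δ : NormOne K T} {c c' : Z1 Gal(Ks/K) M} (h : IsKummerClass χ δ c)
    (h' : IsKummerClass χ δ c') :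
    (QuotientAddGroup.mk c : H1 Gal(Ks/K) M) = QuotientAddGroup.mk c' := by
  obtain ⟨θ, h3, hN, hc⟩ := h
  obtain ⟨θ', h3', hN', hc'⟩ := h'
  obtain ⟨u, hu⟩ := exists_eq_mul_of_pow_three_eq hχ (h3'.trans h3.symm) hN hN'
  exact H1_mk_eq_iff.mpr ⟨u, hc.eq_add hχ heq hc' (fun ι =>
    Finset.prod_ne_zero_iff.mp (hN ▸ one_ne_zero) ι (Finset.mem_univ ι)) hu⟩

theorem IsKummerClass.mul [Fintype (Coord K Ks T)] (hχ : IsCubicPairing χ)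
    {δ δ' : NormOne K T} {c c' : Z1 Gal(Ks/K) M} (h : IsKummerClass χ δ c)
    (h' : IsKummerClass χ δ' c') : IsKummerClass χ (δ * δ') (c + c') := by
  obtain ⟨θ, h3, hN, hc⟩ := h
  obtain ⟨θ', h3', hN', hc'⟩ := h'
  refine ⟨θ * θ', ?_, ?_, fun g ι => ?_⟩
  · rw [mul_pow, h3, h3', Subgroup.coe_mul, Units.val_mul, map_mul]
  · simp only [Pi.mul_apply, Finset.prod_mul_distrib, hN, hN', mul_one]
  · rw [Pi.mul_apply, map_mul, hc, hc', AddSubgroup.coe_add, Pi.add_apply, hχ.map_add,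
      Pi.mul_apply, mul_mul_mul_comm]

theorem isKummerClass_pow_three [Fintype (Coord K Ks T)] [IsSepClosed Ks] [Algebra.Etale K T]
    (hχ : IsCubicPairing χ) (t : NormOne K T) :
    IsKummerClass χ (t ^ 3) (0 : Z1 Gal(Ks/K) M) := by
  refine ⟨minkowski K Ks T ((t : Tˣ) : T), ?_, prod_coord_eq_one t, fun g ι => ?_⟩
  · rw [← map_pow]
    rfl
  · rw [AddSubgroup.coe_zero, Pi.zero_apply, hχ.map_zero, one_mul]
    rfl

theorem exists_isKummerClass [Fintype (Coord K Ks T)] [IsSepClosure K Ks] [NeZero (3 : Ks)]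
    [Algebra.Etale K T] (hχ : IsCubicPairing χ) (heq : IsEquivariant χ) (δ : NormOne K T) :
    ∃ c : Z1 Gal(Ks/K) M, IsKummerClass χ δ c := by
  have : IsSepClosed Ks := IsSepClosure.sep_closed K
  have := Algebra.FormallyUnramified.finite_of_free K T
  obtain ⟨i, -⟩ := hχ.exists_generators
  obtain ⟨θ, h3, hN⟩ := exists_cube_root i δ
  obtain ⟨c, hc⟩ := exists_isKummerCocycle hχ heq h3 hN
  exact ⟨c, θ, h3, hN, hc⟩

/-- A norm-one unit whose Kummer class is trivial is the cube of a norm-one unit. -/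
theorem IsKummerClass.exists_pow_three_eq [Fintype (Coord K Ks T)] [IsSepClosure K Ks]
    [Algebra.Etale K T] (hχ : IsCubicPairing χ) (heq : IsEquivariant χ) {δ : NormOne K T}
    {c : Z1 Gal(Ks/K) M} (h : IsKummerClass χ δ c)
    (h0 : (QuotientAddGroup.mk c : H1 Gal(Ks/K) M) = 0) : ∃ t : NormOne K T, t ^ 3 = δ := by
  have : IsSepClosed Ks := IsSepClosure.sep_closed K
  obtain ⟨θ, h3, hN, hc⟩ := h
  obtain ⟨u, hu⟩ := H1_mk_eq_iff.mp h0
  have hcu : ∀ g, g • u + (c : Gal(Ks/K) → M) g = u := by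
    intro g
    have := hu g
    rw [AddSubgroup.coe_zero, Pi.zero_apply] at this
    rw [← sub_eq_zero, add_comm, add_sub_assoc, ← this]
  -- Since `c` is the coboundary of `-u`, multiplying `θ` by `u` gives an invariant cube root, which
  -- descends.
  obtain ⟨t, ht⟩ := exists_normOne_minkowski_eq (K := K) (v := fun ι => χ ι u * θ ι)
    (fun g ι => by rw [map_mul, hc, ← heq, ← mul_assoc, ← hχ.map_add, hcu])
    (by rw [Finset.prod_mul_distrib, hχ.prod_eq_one, hN, one_mul])
  refine ⟨t, Subtype.ext (Units.ext (minkowski_injective (K := K) (Ks := Ks) ?_))⟩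
  rw [← h3, Subgroup.coe_pow, Units.val_pow_eq_pow_val, map_pow, ht]
  funext ι
  simp only [Pi.pow_apply, mul_pow, hχ.pow_three, one_mul]

/-- Every class is a Kummer class. -/
theorem exists_isKummerClass_of_cocycle [Fintype (Coord K Ks T)] [IsSepClosure K Ks]
    [Algebra.Etale K T] (hχ : IsCubicPairing χ) (heq : IsEquivariant χ) (σ : Z1 Gal(Ks/K) M) :
    ∃ δ : NormOne K T, IsKummerClass χ δ σ := by
  have : IsSepClosed Ks := IsSepClosure.sep_closed K
  have := Algebra.FormallyUnramified.finite_of_free K T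
  obtain ⟨η, hne, hη⟩ := exists_twisted_invariant hχ heq σ
  let n := ∏ ι, η ι
  have hn0 : n ≠ 0 := Finset.prod_ne_zero_iff.mpr fun ι _ => hne ι
  have hn : ∀ g : Gal(Ks/K), g n = n := by
    intro g
    simp only [n, map_prod, hη, Finset.prod_mul_distrib]
    have h1 := Equiv.prod_comp (MulAction.toPerm g)
      fun ι : Coord K Ks T => χ ι (-(σ : Gal(Ks/K) → M) g)
    have h2 := Equiv.prod_comp (MulAction.toPerm g) η
    simp only [MulAction.toPerm_apply] at h1 h2
    rw [h1, h2, hχ.prod_eq_one, one_mul]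
  -- `η` has cocycle `-σ`, so its square has `-2σ = σ`. The Galois-fixed scalar `n⁻¹` leaves this
  -- unchanged and, over two coordinates, cancels the norm `n²` of the square.
  have hθ : IsKummerCocycle χ (fun ι => n⁻¹ * η ι ^ 2) (σ : Gal(Ks/K) → M) := by
    intro g ι
    have h1 : χ (g • ι) (-(σ : Gal(Ks/K) → M) g) ^ 2 = χ (g • ι) ((σ : Gal(Ks/K) → M) g) := by
      rw [hχ.map_neg, inv_pow]
      refine inv_eq_of_mul_eq_one_left ?_
      rw [← hχ.pow_three (g • ι) ((σ : Gal(Ks/K) → M) g)]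
      ring
    rw [map_mul, map_inv₀, hn, map_pow, hη, mul_pow, h1]
    ring
  have hN : ∏ ι : Coord K Ks T, n⁻¹ * η ι ^ 2 = 1 := by
    rw [Finset.prod_mul_distrib, Finset.prod_pow, Finset.prod_const, Finset.card_univ,
      ← Nat.card_eq_fintype_card, hχ.card_left, ← mul_pow, inv_mul_cancel₀ hn0, one_pow]
  obtain ⟨δ, hδ⟩ := exists_normOne_minkowski_eq (K := K) (v := fun ι => (n⁻¹ * η ι ^ 2) ^ 3)
    (fun g ι => by
      have h1 := hθ g ι
      simp only at h1
      rw [map_pow, h1, mul_pow, hχ.pow_three, one_mul])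
    (by rw [Finset.prod_pow, hN, one_pow])
  exact ⟨δ, _, hδ.symm, hN, hθ⟩

/-- The Kummer isomorphism. -/
theorem exists_kummer_equiv [Fintype (Coord K Ks T)] [IsSepClosure K Ks] [NeZero (3 : Ks)]
    [Algebra.Etale K T] (hχ : IsCubicPairing χ) (heq : IsEquivariant χ) :
    ∃ Φ : H1 Gal(Ks/K) M ≃+ Additive (NormOneModCubes K T),
      ∀ (δ : NormOne K T) (c : Z1 Gal(Ks/K) M), IsKummerClass χ δ c →
        Φ (QuotientAddGroup.mk c) = Additive.ofMul (QuotientGroup.mk δ) := by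
  have : IsSepClosed Ks := IsSepClosure.sep_closed K
  choose k hk using exists_isKummerClass (T := T) hχ heq
  let Ψ : NormOne K T →* Multiplicative (H1 Gal(Ks/K) M) :=
    MonoidHom.mk' (fun δ => Multiplicative.ofAdd (QuotientAddGroup.mk (k δ))) fun δ δ' =>
      congrArg Multiplicative.ofAdd
        ((hk (δ * δ')).mk_eq hχ heq ((hk δ).mul hχ (hk δ')))
  have hΨ : ∀ δ c, IsKummerClass χ δ c → Ψ δ = Multiplicative.ofAdd (QuotientAddGroup.mk c) :=
    fun δ c h => congrArg Multiplicative.ofAdd ((hk δ).mk_eq hχ heq h)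
  have hsurj : Function.Surjective Ψ := by
    intro z
    obtain ⟨σ, hσ⟩ := QuotientAddGroup.mk_surjective (Multiplicative.toAdd z)
    obtain ⟨δ, hδ⟩ := exists_isKummerClass_of_cocycle (T := T) hχ heq σ
    exact ⟨δ, (hΨ δ σ hδ).trans (congrArg Multiplicative.ofAdd hσ)⟩
  have hker : (powMonoidHom 3 : NormOne K T →* NormOne K T).range = Ψ.ker := by
    ext δ
    rw [MonoidHom.mem_range, MonoidHom.mem_ker]
    constructor
    · rintro ⟨t, rfl⟩
      exact hΨ _ _ (isKummerClass_pow_three hχ t)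
    · intro h
      exact (hk δ).exists_pow_three_eq hχ heq (congrArg Multiplicative.toAdd h)
  let e : NormOneModCubes K T ≃* Multiplicative (H1 Gal(Ks/K) M) :=
    (QuotientGroup.quotientMulEquivOfEq hker).trans
      (QuotientGroup.quotientKerEquivOfSurjective Ψ hsurj)
  refine ⟨(MulEquiv.toAdditiveLeft e).symm, fun δ c h => ?_⟩
  rw [AddEquiv.symm_apply_eq]
  exact congrArg Multiplicative.toAdd (hΨ δ c h).symm

end KummerIsomorphism

/-! ## The cubic algebra attached to a cube root -/

section CubicAlgebra

variable {K Ks T M : Type*} [Field K] [Field Ks] [Algebra K Ks] [CommRing T] [Algebra K T]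
  [AddCommGroup M] {χ : Coord K Ks T → M → Ks}

theorem kappa_apply [Fintype (Coord K Ks T)] (θ : Coord K Ks T → Ks) (p : K × T)
    (ω : Omega Ks (Coord K Ks T)) :
    kappa K Ks T θ p ω = algebraMap K Ks p.1 + ∑ ι, ι p.2 * ω.1 ι * θ ι := by
  change algebraMap K Ks p.1 + Algebra.trace Ks _ _ = _
  rw [trace_pi]
  rfl

theorem kappa_injective [Fintype (Coord K Ks T)] [IsSepClosed Ks] [NeZero (3 : Ks)]
    [Algebra.Etale K T] (hχ : IsCubicPairing χ)
    {w : M ≃ Omega Ks (Coord K Ks T)} (hw : ∀ x ι, (w x).1 ι = χ ι x)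
    {θ : Coord K Ks T → Ks} (hne : ∀ ι, θ ι ≠ 0) : Function.Injective (kappa K Ks T θ) := by
  rw [injective_iff_map_eq_zero]
  rintro ⟨a, ξ⟩ h
  obtain ⟨h1, h2⟩ := hχ.eq_zero_of_forall (NeZero.ne (3 : Ks)) (a := algebraMap K Ks a)
    (b := fun ι => ι ξ * θ ι) fun x => by
      refine Eq.trans ?_ (congrFun h (w x))
      rw [kappa_apply]
      simp only [hw, mul_right_comm]
  refine Prod.ext ((map_eq_zero _).mp h1) (minkowski_injective (K := K) (Ks := Ks) ?_)
  rw [Prod.snd_zero, map_zero]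
  exact funext fun ι => (mul_eq_zero.mp (congrFun h2 ι)).resolve_right (hne ι)

variable [DistribMulAction Gal(Ks/K) M]

/-- The twisted-equivariant functions on `X`, a set parametrised by `M`. -/
def twistedInvariants {X : Type*} (w : M ≃ X) (c : Gal(Ks/K) → M) : Subalgebra K (X → Ks) where
  carrier := {y | ∀ g x, g (y (w x)) = y (w (g • x + c g))}
  mul_mem' ha hb g x := by rw [Pi.mul_apply, map_mul, ha, hb, Pi.mul_apply]
  add_mem' ha hb g x := by rw [Pi.add_apply, map_add, ha, hb, Pi.add_apply]
  algebraMap_mem' r g x := by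
    simp only [Pi.algebraMap_apply]
    exact g.commutes r

theorem mem_twistedInvariants {X : Type*} {w : M ≃ X} {c : Gal(Ks/K) → M} {y : X → Ks} :
    y ∈ twistedInvariants (K := K) w c ↔ ∀ g x, g (y (w x)) = y (w (g • x + c g)) := Iff.rfl

/-- Twisted invariance makes the trivial Fourier coefficient of `y` Galois-fixed and makes the other
two transform exactly as `θ` does. Their quotients by `θ` therefore descend to `T`. -/
theorem range_kappa [Fintype (Coord K Ks T)] [IsSepClosure K Ks] [NeZero (3 : Ks)]
    [Algebra.Etale K T] (hχ : IsCubicPairing χ) (heq : IsEquivariant χ)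
    {w : M ≃ Omega Ks (Coord K Ks T)} (hw : ∀ x ι, (w x).1 ι = χ ι x)
    {θ : Coord K Ks T → Ks} (hne : ∀ ι, θ ι ≠ 0) {c : Gal(Ks/K) → M}
    (hc : IsKummerCocycle χ θ c) :
    (twistedInvariants w c : Set (Omega Ks (Coord K Ks T) → Ks))
      = Set.range (kappa K Ks T θ) := by
  ext y
  rw [SetLike.mem_coe, mem_twistedInvariants]
  constructor
  · intro hy
    have := hχ.finite_right
    have := Fintype.ofFinite M
    have h3 : (3 : Ks) ≠ 0 := NeZero.ne _
    have hg3 : ∀ g : Gal(Ks/K), g 3 = 3 := fun g => map_ofNat g 3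
    have hperm : ∀ g : Gal(Ks/K), Function.Bijective fun z : M => g • z + c g := fun g =>
      ((MulAction.toPerm g).trans (Equiv.addRight (c g))).bijective
    obtain ⟨a, ha⟩ : 3⁻¹ * ∑ z, y (w z) ∈ Set.range (algebraMap K Ks) := by
      refine (InfiniteGalois.mem_range_algebraMap_iff_fixed _).mpr fun g => ?_
      rw [map_mul, map_inv₀, hg3, map_sum]
      simp only [hy]
      rw [(hperm g).sum_comp fun z => y (w z)]
    obtain ⟨ξ, hξ⟩ : ∃ ξ : T, minkowski K Ks T ξ
        = fun ι => 3⁻¹ * (∑ z, χ ι (-z) * y (w z)) / θ ι := by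
      refine exists_minkowski_eq fun g ι => ?_
      rw [map_div₀, map_mul, map_inv₀, hg3, map_sum, hc,
        ← (hperm g).sum_comp fun z => χ (g • ι) (-z) * y (w z)]
      simp only [map_mul, hy, neg_add, hχ.map_add _ (-_), hχ.map_neg _ (c g)]
      simp only [mul_right_comm _ (χ (g • ι) (c g))⁻¹, ← Finset.sum_mul]
      field_simp [hχ.ne_zero (g • ι) (c g), hne (g • ι)]
      exact Finset.sum_congr rfl fun x _ => by rw [← smul_neg, heq]
    refine ⟨(a, ξ), funext fun ω => ?_⟩
    obtain ⟨x, rfl⟩ := w.surjective ω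
    rw [kappa_apply, ha]
    apply mul_left_cancel₀ h3
    rw [hχ.fourier_inversion (fun z => y (w z)) x, mul_add, mul_inv_cancel_left₀ h3,
      Finset.mul_sum]
    congr 1
    refine Finset.sum_congr rfl fun ι _ => ?_
    have h1 : ι ξ = 3⁻¹ * (∑ z, χ ι (-z) * y (w z)) / θ ι := congrFun hξ ι
    rw [h1, hw]
    have := hne ι
    field_simp
  · rintro ⟨⟨a, ξ⟩, rfl⟩ g x
    rw [kappa_apply, kappa_apply, map_add, AlgEquiv.commutes, map_sum,
      ← Equiv.sum_comp (MulAction.toPerm g)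
        fun ι : Coord K Ks T => ι ξ * (w (g • x + c g)).1 ι * θ ι]
    congr 1
    refine Finset.sum_congr rfl fun ι _ => ?_
    rw [MulAction.toPerm_apply, map_mul, map_mul, hw, hw, ← heq, hc, hχ.map_add, smul_coord_apply]
    ring

theorem finite_coord [Module.Finite K T] : Finite (Coord K Ks T) := by
  rw [← Cardinal.mk_lt_aleph0_iff]
  exact (cardinalMk_algHom K T Ks).trans_lt (Cardinal.natCast_lt_aleph0)

/-- The image of `κ` is a cubic étale algebra, whose coordinates are the projections. -/
theorem exists_cubic_algebra [Fintype (Coord K Ks T)] [IsSepClosure K Ks] [NeZero (3 : Ks)]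
    [Algebra.Etale K T] (hχ : IsCubicPairing χ) (heq : IsEquivariant χ)
    {w : M ≃ Omega Ks (Coord K Ks T)} (hw : ∀ x ι, (w x).1 ι = χ ι x)
    {θ : Coord K Ks T → Ks} (hne : ∀ ι, θ ι ≠ 0) {c : Gal(Ks/K) → M}
    (hc : IsKummerCocycle χ θ c) :
    ∃ L : Subalgebra K (Omega Ks (Coord K Ks T) → Ks),
      (L : Set (Omega Ks (Coord K Ks T) → Ks)) = Set.range (kappa K Ks T θ) ∧
      Algebra.Etale K L ∧ Module.finrank K L = 3 ∧
      ∃ π : M ≃ Coord K Ks L, (∀ (x : M) (y : L), π x y = y.1 (w x)) ∧ IsLabelling c π := by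
  have : IsSepClosed Ks := IsSepClosure.sep_closed K
  have := Algebra.FormallyUnramified.finite_of_free K T
  have := hχ.finite_right
  have : Finite (Omega Ks (Coord K Ks T)) := .of_equiv M w
  have hrange := range_kappa hχ heq hw hne hc
  let L : Subalgebra K (Omega Ks (Coord K Ks T) → Ks) := twistedInvariants w c
  have hsub : Subalgebra.toSubmodule L = LinearMap.range (kappa K Ks T θ) :=
    SetLike.coe_injective hrange
  have hfin : Module.Finite K L := by
    change Module.Finite K (Subalgebra.toSubmodule L)
    rw [hsub]
    infer_instance
  have hrank : Module.finrank K L = 3 := by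
    change Module.finrank K (Subalgebra.toSubmodule L) = 3
    rw [hsub, LinearMap.finrank_range_of_inj (kappa_injective hχ hw hne), Module.finrank_prod,
      Module.finrank_self, finrank_eq_card_coord (Ks := Ks), hχ.card_left]
  let p (x : M) : Coord K Ks L :=
    (Pi.evalAlgHom K (fun _ : Omega Ks (Coord K Ks T) => Ks) (w x)).comp L.val
  have hp : Function.Injective p := by
    intro x x' hxx
    obtain ⟨i, -⟩ := hχ.exists_generators
    apply hχ.injective i
    -- Projections agreeing on every `κ(0, ξ)` give a linear relation between the coordinates of
    -- `T`, which must be trivial.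
    have h1 : (fun ι => (χ ι x - χ ι x') * θ ι) = 0 := by
      refine coord_sum_eq_zero (K := K) fun ξ => ?_
      have hmem : kappa K Ks T θ (0, ξ) ∈ L := by
        rw [← SetLike.mem_coe, hrange]
        exact ⟨_, rfl⟩
      have h2 : kappa K Ks T θ (0, ξ) (w x) = kappa K Ks T θ (0, ξ) (w x') :=
        DFunLike.congr_fun hxx ⟨_, hmem⟩
      rw [kappa_apply, kappa_apply, add_right_inj] at h2
      rw [← sub_eq_zero, ← Finset.sum_sub_distrib] at h2
      rw [← h2]
      refine Finset.sum_congr rfl fun ι _ => ?_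
      rw [hw, hw]
      ring
    exact sub_eq_zero.mp ((mul_eq_zero.mp (congrFun h1 i)).resolve_right (hne i))
  -- An algebra of rank 3 has at most three coordinates, so the three distinct projections exhaust
  -- them.
  have hcard : Nat.card (Coord K Ks L) ≤ Nat.card M := by
    have := finite_coord (K := K) (Ks := Ks) (T := L)
    rw [hχ.card_right, ← hrank]
    exact card_coord_le_finrank
  have := finite_coord (K := K) (Ks := Ks) (T := L)
  refine ⟨L, hrange, etale_subalgebra_pi L, hrank,
    Equiv.ofBijective p (hp.bijective_of_nat_card_le hcard), fun _ _ => rfl, fun g x => ?_⟩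
  exact AlgHom.ext fun y => y.2 g x

/-- Comparing labels gives `g(x + t) + c(g) = gx + σ(g) + t`, in which `x` cancels. -/
theorem IsLabelling.addRight_trans_iff {L : Type*} [CommRing L] [Algebra K L]
    {c σ : Gal(Ks/K) → M} {π : M ≃ Coord K Ks L} (hπ : IsLabelling c π) (t : M) :
    IsLabelling σ ((Equiv.addRight t).trans π) ↔ ∀ g, c g = σ g + (g • (-t) - -t) := by
  have h : ∀ g x, galCoord g (((Equiv.addRight t).trans π) x)
      = ((Equiv.addRight t).trans π) (g • x + σ g) ↔ c g = σ g + (g • (-t) - -t) := by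
    intro g x
    simp only [Equiv.trans_apply, Equiv.coe_addRight]
    rw [hπ, π.injective.eq_iff, smul_add, smul_neg, add_assoc, add_assoc, add_right_inj,
      ← eq_sub_iff_add_eq', sub_neg_eq_add]
    refine Eq.congr_right ?_
    abel
  exact ⟨fun hl g => (h g 0).mp (hl g 0), fun hg g x => (h g x).mpr (hg g)⟩

end CubicAlgebra

/-- Evaluation identifies `M` with the cube roots of unity of norm one. -/
theorem exists_equiv_omega {Ks M C : Type*} [Field Ks] [AddCommGroup M] [Fintype C]
    {χ : C → M → Ks} (hχ : IsCubicPairing χ) :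
    ∃ w : M ≃ Omega Ks C, ∀ x ι, (w x).1 ι = χ ι x := by
  refine ⟨Equiv.ofBijective (fun x => ⟨fun ι => χ ι x, funext fun ι => hχ.pow_three ι x,
    (norm_pi _).trans (hχ.prod_eq_one x)⟩) ⟨fun x y hxy => ?_, fun ω => ?_⟩, fun _ _ => rfl⟩
  · obtain ⟨i, -⟩ := hχ.exists_generators
    exact hχ.injective i (congrFun (congrArg Subtype.val hxy) i)
  · obtain ⟨x, hx⟩ := hχ.exists_eq ω.2.1 ((norm_pi _).symm.trans ω.2.2)
    exact ⟨x, Subtype.ext (funext hx)⟩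

end

end KummerCubic

/-! ### The main theorem -/

open KummerCubic in
theorem mainTheorem2 {K Ks M T' : Type*}
    [Field K] [Field Ks] [Algebra K Ks] [IsSepClosure K Ks]
    (h2 : ringChar K ≠ 2) (h3 : ringChar K ≠ 3)
    [AddCommGroup M] [TopologicalSpace M] [DiscreteTopology M]
    [DistribMulAction Gal(Ks/K) M] [ContinuousSMul Gal(Ks/K) M] (hM : Nat.card M = 3)
    [CommRing T'] [Algebra K T'] [Algebra.Etale K T']
    (e : Coord K Ks T' ≃ MaxOrder (TateDual Ks M))
    (he : ∀ (g : Gal(Ks/K)) (ι : Coord K Ks T'), (e (galCoord g ι)).1 = g • (e ι).1) :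
    ∃ w : M ≃ Omega Ks (Coord K Ks T'),
      (∀ (x : M) (ι : Coord K Ks T'), (w x).1 ι = (e ι).1.eval x) ∧
      ∃ Φ : H1 Gal(Ks/K) M ≃+ Additive (NormOneModCubes K T'),
        ∀ δ : NormOne K T',
          (∃ θ : Coord K Ks T' → Ks,
            θ ^ 3 = minkowski K Ks T' ((δ : T'ˣ) : T') ∧ Algebra.norm Ks θ = 1) ∧
          ∀ θ : Coord K Ks T' → Ks,
            θ ^ 3 = minkowski K Ks T' ((δ : T'ˣ) : T') → Algebra.norm Ks θ = 1 →
            ∃ L : Subalgebra K (Omega Ks (Coord K Ks T') → Ks),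
              (L : Set (Omega Ks (Coord K Ks T') → Ks)) = Set.range (kappa K Ks T' θ) ∧
              Algebra.Etale K L ∧ Module.finrank K L = 3 ∧
              ∃ π : M ≃ Coord K Ks L,
                (∀ (x : M) (y : L), π x y = y.1 (w x)) ∧
                ∀ σ : Z1 Gal(Ks/K) M,
                  Φ (QuotientAddGroup.mk σ) = Additive.ofMul (QuotientGroup.mk δ) ↔
                    ∃ t : M, IsLabelling (σ : Gal(Ks/K) → M) ((Equiv.addRight t).trans π) := by
  have : IsSepClosed Ks := IsSepClosure.sep_closed K
  have hK3 : (3 : K) ≠ 0 := by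
    intro h
    have hd : ringChar K ∣ 3 := (ringChar.spec K 3).mp (by exact_mod_cast h)
    rcases (Nat.dvd_prime Nat.prime_three).mp hd with h1 | h1
    · exact CharP.ringChar_ne_one h1
    · exact h3 h1
  have : NeZero (3 : Ks) := ⟨by
    rw [← map_ofNat (algebraMap K Ks) 3]
    exact (map_ne_zero _).mpr hK3⟩
  let χ : Coord K Ks T' → M → Ks := fun ι x => (e ι).1.eval x
  have hχ : IsCubicPairing χ := isCubicPairing_eval hM e
  have heq : IsEquivariant χ := by
    intro g ι x
    change (e (galCoord g ι)).1.eval (g • x) = g ((e ι).1.eval x)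
    rw [he, TateDual.eval_smul, inv_smul_smul]
  have := hχ.finite_left
  have := Fintype.ofFinite (Coord K Ks T')
  have := Algebra.FormallyUnramified.finite_of_free K T'
  obtain ⟨w, hw⟩ := exists_equiv_omega hχ
  obtain ⟨Φ, hΦ⟩ := exists_kummer_equiv (T := T') hχ heq
  refine ⟨w, hw, Φ, fun δ => ⟨?_, fun θ hθ hN => ?_⟩⟩
  · obtain ⟨i, -⟩ := hχ.exists_generators
    obtain ⟨θ, hθ, hN⟩ := exists_cube_root i δ
    exact ⟨θ, hθ, (norm_pi θ).trans hN⟩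
  · rw [norm_pi] at hN
    obtain ⟨c, hc⟩ := exists_isKummerCocycle hχ heq hθ hN
    obtain ⟨L, hL, het, hrank, π, hπ, hlab⟩ := exists_cubic_algebra hχ heq hw (fun ι =>
      Finset.prod_ne_zero_iff.mp (hN ▸ one_ne_zero) ι (Finset.mem_univ ι)) hc
    refine ⟨L, hL, het, hrank, π, hπ, fun σ => ?_⟩
    -- The condition becomes that `σ` and the cocycle `c` of `θ` are cohomologous; the coboundary of
    -- `u` corresponds to translation by `t = -u`.
    rw [← hΦ δ c ⟨θ, hθ, hN, hc⟩, Φ.injective.eq_iff, H1_mk_eq_iff]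
    simp only [hlab.addRight_trans_iff]
    exact ⟨fun ⟨u, hu⟩ => ⟨-u, by simpa using hu⟩, fun ⟨t, ht⟩ => ⟨-t, ht⟩⟩
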